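/- Let $k$ be a field and $n\ge 2$. **Diagrams.** A $k$-diagram $\mathcal F$ consists of $k$-vector spaces $\mathcal F(B_1),\mathcal F(B_2),\mathcal F(B_3),\mathcal F(A_1),\mathcal F(A_2)$ and linear maps $\rho_{11}:B_1\to A_1$, $\rho_{22}:B_2\to A_2$, $\rho_{31}:B_3\to A_1$, $\rho_{32}:B_3\to A_2$; isomorphisms and direct sums are taken value by value. $H^0(\mathcal F)$ and $H^1(\mathcal F)$ are the kernel and cokernel of $\partial(b_1,b_2,b_3)=(\rho_{11}b_1-\rho_{31}b_3,\ \rho_{22}b_2-\rho_{32}b_3)$, and $\mathcal F$ is Fredholm if both are finite dimensional. A virtual $k$-diagram (resp. virtual $k$-vector space) is a formal difference $\mathcal F_1\ominus\mathcal F_2$ of Fredholm $k$-diagrams (resp. of finite dimensional vector spaces); $\mathcal F_1\ominus\mathcal F_2$ and $\mathcal F_1'\ominus\mathcal F_2'$ are equivalent (isomorphic) if $\mathcal F_1\oplus\mathcal F_2'\oplus\mathcal F_0\simeq\mathcal F_1'\oplus\mathcal F_2\oplus\mathcal F_0$ for some $\mathcal F_0$ of the same kind. On classes, $H^i([\mathcal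 F_1\ominus\mathcal F_2])=[H^i(\mathcal F_1)\ominus H^i(\mathcal F_2)]$ and $[V_1\ominus V_2]^*=[V_1^*\ominus V_2^*]$. **Models.** For $W:\mathbb Z^2\to\mathbb Z_{\ge0}$ and $\mathbf d\in\mathbb Z^2$, $\mathcal M_{W,\mathbf d}$ has $B_i=k^{\oplus\mathbb Z_{\le d_i}}$, $A_i=k^{\oplus\mathbb Z}$, $B_3=k^{\oplus W}$ (one copy of $k$ for each element of the multiset with multiplicities $W$), with inclusions $\rho_{ii}$ and projections $\rho_{3i}$; and $\mathcal I_{\mathbf d}^{\oplus W}=\bigoplus_{\mathbf a}\mathcal I_{\mathbf d\ge\mathbf a}^{\oplus W(\mathbf a)}$, where $\mathcal I_{\mathbf d\ge\mathbf a}$ has values $k$ at $B_3,A_1,A_2$, value $k$ at $B_i$ if $a_i\le d_i$ and $0$ otherwise, and identities and inclusions as maps. A function on $\mathbb Z^n$ is initially (eventually) zero if it vanishes in all sufficiently small (large) degrees, where $\deg\mathbf d=d_1+\dots+d_n$. A perfect matching is an initially and eventually zero $W:\mathbb Z^2\to\mathbb Z$ that is the indicator function of the graph of a bijection $\mathbb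 Z\to\mathbb Z$. For any initially and eventually zero $W:\mathbb Z^2\to\mathbb Z$, $[\mathcal M_{W,\mathbf d}]$ denotes the class of $\mathcal I_{\mathbf d}^{\oplus W^+}\ominus\mathcal I_{\mathbf d}^{\oplus W^-}$, where $W^{\pm}=\max(\pm W,0)$. **Riemann functions.** $f:\mathbb Z^n\to\mathbb Z$ is a Riemann function with offset $C$ if it is initially zero and $f(\mathbf d)=\deg(\mathbf d)+C$ for $\deg\mathbf d$ sufficiently large; its $\mathbf K$-dual is $f^\wedge_{\mathbf K}(\mathbf d)=f(\mathbf K-\mathbf d)-\deg(\mathbf K-\mathbf d)-C$. For $i\neq j$ put $f_{i,j,\mathbf d}(a_1,a_2)=f(\mathbf d+a_1\mathbf e_i+a_2\mathbf e_j)$; for $g:\mathbb Z^2\to\mathbb Z$ put $(\mathfrak m g)(\mathbf a)=\sum_{I\subset\{1,2\}}(-1)^{|I|}g(\mathbf a-\mathbf e_I)$; and put $W^*_{\mathbf L}(\mathbf a)=W(\mathbf L-\mathbf a)$. Let $[\mathcal M_{f;i,j,\mathbf d}]=[\mathcal M_{\mathfrak m f_{i,j,\mathbf d},\mathbf 0}]$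 and $[\mathcal M_{f\text{ at }\mathbf d}]=[\mathcal M_{f;1,2,\mathbf d}]$. **Theorem.** Let $f:\mathbb Z^n\to\mathbb Z$ be an arbitrary Riemann function and $\mathbf d,\mathbf K\in\mathbb Z^n$. 1. For all distinct $i,j$, $[\mathcal M_{f;i,j,\mathbf d}]=[\mathcal M_{f\text{ at }\mathbf d}]$. Whenever $\mathfrak m f_{i,j,\mathbf d}=(W_1+\dots+W_s)-(\tilde W_1+\dots+\tilde W_{s-1})$ with all $W_\ell,\tilde W_\ell$ perfect matchings, all $\mathcal M_{W_\ell,\mathbf 0}$ and $\mathcal M_{\tilde W_\ell,\mathbf 0}$ are Fredholm and this class is that of $\bigoplus_\ell\mathcal M_{W_\ell,\mathbf 0}\ominus\bigoplus_\ell\mathcal M_{\tilde W_\ell,\mathbf 0}$; such a decomposition exists if $\mathfrak m f_{i,j,\mathbf d}$ is bounded. 2. For $i=0,1$ there is an isomorphism of virtual $k$-vector spaces $$H^i\bigl([\mathcal M_{f\text{ at }\mathbf d}]\bigr)^*\to H^{1-i}\bigl([\mathcal M_{f^\wedge_{\mathbf K}\text{ at }\mathbf K-\mathbf d}]\bigr).$$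 3. It arises from two-variable duality: let $\mathbf d'=\mathbf d-d_1\mathbf e_1-d_2\mathbf e_2$, $W=\mathfrak m f_{1,2,\mathbf d'}$, $\delta=(d_1,d_2)$, $\kappa=(K_1,K_2)$, $\mathbf L=\kappa+(1,1)$. Then $[\mathcal M_{f\text{ at }\mathbf d}]=[\mathcal M_{W,\delta}]$ and $[\mathcal M_{f^\wedge_{\mathbf K}\text{ at }\mathbf K-\mathbf d}]=[\mathcal M_{W^*_{\mathbf L},\kappa-\delta}]$. For every decomposition $W=\sum_{\ell\le s}W_\ell-\sum_{\ell\le s-1}\tilde W_\ell$ into perfect matchings, these two classes are those of $\bigoplus_\ell\mathcal M_{W_\ell,\delta}\ominus\bigoplus_\ell\mathcal M_{\tilde W_\ell,\delta}$ and $\bigoplus_\ell\mathcal M_{(W_\ell)^*_{\mathbf L},\kappa-\delta}\ominus\bigoplus_\ell\mathcal M_{(\tilde W_\ell)^*_{\mathbf L},\kappa-\delta}$, and there are isomorphisms of vector spaces $$H^i\Bigl(\bigoplus_\ell\mathcal M_{W_\ell,\delta}\Bigr)^*\to H^{1-i}\Bigl(\bigoplus_\ell\mathcal M_{(W_\ell)^*_{\mathbf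 L},\kappa-\delta}\Bigr),\qquad i=0,1,$$ and likewise for the $\tilde W_\ell$. For $i=1$ the isomorphism sends a functional $w$ to the global section whose coefficient at the basis vector $\mathbf e_m$ ($m\le K_1-d_1$) of the $\ell$-th summand of $B_1$ is $w$ of the class of $(\mathbf e_{K_1+1-m},0)$ in the $\ell$-th summand of $A_1\oplus A_2$; for $i=0$ it is the transpose of the corresponding $i=1$ isomorphism with the two sides exchanged. The same holds with any two distinct coordinates in place of $1,2$. -/

import Mathlib

universe u v

/-! ### Functions on `ℤⁿ`: Riemann functions, duals, restrictions, weights -/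

/-- The degree `d₁ + ⋯ + dₙ` of `d ∈ ℤⁿ`. -/
def deg {n : ℕ} (d : Fin n → ℤ) : ℤ := ∑ i, d i

/-- `W` vanishes in all sufficiently small degrees. -/
def InitiallyZero {n : ℕ} (W : (Fin n → ℤ) → ℤ) : Prop :=
  ∃ a : ℤ, ∀ d, deg d ≤ a → W d = 0

/-- `W` vanishes in all sufficiently large degrees. -/
def EventuallyZero {n : ℕ} (W : (Fin n → ℤ) → ℤ) : Prop :=
  ∃ b : ℤ, ∀ d, b ≤ deg d → W d = 0

/-- `f : ℤⁿ → ℤ` is a Riemann function with offset `C`. -/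
def IsRiemannFunction {n : ℕ} (f : (Fin n → ℤ) → ℤ) (C : ℤ) : Prop :=
  InitiallyZero f ∧ ∃ b : ℤ, ∀ d, b ≤ deg d → f d = deg d + C

/-- The `K`-dual `f^∧_K` of a Riemann function `f` with offset `C`. -/
def riemannDual {n : ℕ} (f : (Fin n → ℤ) → ℤ) (C : ℤ) (K : Fin n → ℤ) : (Fin n → ℤ) → ℤ :=
  fun d => f (K - d) - deg (K - d) - C

/-- The two-variable restriction `f_{i,j,d}(a₁, a₂) = f (d + a₁ eᵢ + a₂ eⱼ)`. -/
def restrictTwo {n : ℕ} (f : (Fin n → ℤ) → ℤ) (i j : Fin n) (d : Fin n → ℤ) :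
    (Fin 2 → ℤ) → ℤ :=
  fun a => f (d + Pi.single i (a 0) + Pi.single j (a 1))

/-- The weight `𝔪 f` of `f`: `(𝔪 f)(d) = ∑_{I ⊆ [n]} (-1)^{|I|} f (d - e_I)`. -/
def weight {n : ℕ} (f : (Fin n → ℤ) → ℤ) : (Fin n → ℤ) → ℤ :=
  fun d => ∑ I : Finset (Fin n), (-1) ^ I.card * f (d - ∑ i ∈ I, Pi.single i 1)

/-- The `L`-dual weight `W^*_L (d) = W (L - d)`. -/
def dualWeight {n : ℕ} (W : (Fin n → ℤ) → ℤ) (L : Fin n → ℤ) : (Fin n → ℤ) → ℤ :=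
  fun d => W (L - d)

/-- `W : ℤ² → ℤ` is a perfect matching: it is initially and eventually zero, and it is the
indicator function of the graph of a bijection `π : ℤ → ℤ`. -/
def IsPerfectMatching (W : (Fin 2 → ℤ) → ℤ) : Prop :=
  InitiallyZero W ∧ EventuallyZero W ∧
    ∃ π : Equiv.Perm ℤ, ∀ a, W a = if a 1 = π (a 0) then 1 else 0

/-- A way of writing `W : ℤ² → ℤ` as `(W₁ + ⋯ + W_s) - (W̃₁ + ⋯ + W̃_{s-1})` with all `W_ℓ` and
`W̃_ℓ` perfect matchings; here `s = r + 1`. -/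
structure MatchingDecomposition (W : (Fin 2 → ℤ) → ℤ) where
  r : ℕ
  pos : Fin (r + 1) → (Fin 2 → ℤ) → ℤ
  neg : Fin r → (Fin 2 → ℤ) → ℤ
  pos_perfect : ∀ l, IsPerfectMatching (pos l)
  neg_perfect : ∀ l, IsPerfectMatching (neg l)
  eq_sub : ∀ a, W a = ∑ l, pos l a - ∑ l, neg l a

section RiemannLemmas

variable {n : ℕ}

lemma deg_add (x y : Fin n → ℤ) : deg (x + y) = deg x + deg y := by
  simp [deg, Finset.sum_add_distrib]

lemma deg_sub (x y : Fin n → ℤ) : deg (x - y) = deg x - deg y := by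
  simp [deg, Finset.sum_sub_distrib]

lemma deg_single (i : Fin n) (t : ℤ) : deg (Pi.single i t) = t := by
  simp [deg]

lemma IsRiemannFunction.riemannDual {f : (Fin n → ℤ) → ℤ} {C : ℤ}
    (hf : IsRiemannFunction f C) (K : Fin n → ℤ) :
    IsRiemannFunction (riemannDual f C K) (-deg K - C) := by
  obtain ⟨⟨a, ha⟩, b, hb⟩ := hf
  refine ⟨⟨deg K - b, fun d hd => ?_⟩, deg K - a, fun d hd => ?_⟩
  · have h := hb (K - d) (by rw [deg_sub]; linarith)
    simp [_root_.riemannDual, h]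
  · have h := ha (K - d) (by rw [deg_sub]; linarith)
    simp only [_root_.riemannDual, h, deg_sub]
    ring

lemma IsRiemannFunction.restrictTwo {f : (Fin n → ℤ) → ℤ} {C : ℤ}
    (hf : IsRiemannFunction f C) (i j : Fin n) (d : Fin n → ℤ) :
    IsRiemannFunction (restrictTwo f i j d) (deg d + C) := by
  obtain ⟨⟨a, ha⟩, b, hb⟩ := hf
  have key : ∀ x : Fin 2 → ℤ,
      deg (d + Pi.single i (x 0) + Pi.single j (x 1)) = deg d + deg x := by
    intro x
    rw [deg_add, deg_add, deg_single, deg_single]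
    simp only [deg, Fin.sum_univ_two]
    ring
  refine ⟨⟨a - deg d, fun x hx => ?_⟩, b - deg d, fun x hx => ?_⟩
  · exact ha _ (by rw [key]; linarith)
  · rw [_root_.restrictTwo, hb _ (by rw [key]; linarith), key]
    ring

lemma weight_two (f : (Fin 2 → ℤ) → ℤ) (d : Fin 2 → ℤ) :
    weight f d = f d - f (d - Pi.single 0 1) - f (d - Pi.single 1 1)
      + f (d - (Pi.single 0 1 + Pi.single 1 1)) := by
  have h : (Finset.univ : Finset (Finset (Fin 2))) = {∅, {0}, {1}, {0, 1}} := by decide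
  rw [weight, h, Finset.sum_insert (by decide), Finset.sum_insert (by decide),
    Finset.sum_insert (by decide), Finset.sum_singleton]
  simp
  ring

lemma IsRiemannFunction.weight_initiallyZero {f : (Fin 2 → ℤ) → ℤ} {C : ℤ}
    (hf : IsRiemannFunction f C) : InitiallyZero (weight f) := by
  obtain ⟨⟨a, ha⟩, -⟩ := hf
  refine ⟨a, fun d hd => ?_⟩
  rw [weight_two, ha _ hd, ha _ (by rw [deg_sub, deg_single]; linarith),
    ha _ (by rw [deg_sub, deg_single]; linarith),
    ha _ (by rw [deg_sub, deg_add, deg_single, deg_single]; linarith)]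
  ring

lemma IsRiemannFunction.weight_eventuallyZero {f : (Fin 2 → ℤ) → ℤ} {C : ℤ}
    (hf : IsRiemannFunction f C) : EventuallyZero (weight f) := by
  obtain ⟨-, b, hb⟩ := hf
  refine ⟨b + 2, fun d hd => ?_⟩
  rw [weight_two, hb _ (by linarith), hb _ (by rw [deg_sub, deg_single]; linarith),
    hb _ (by rw [deg_sub, deg_single]; linarith),
    hb _ (by rw [deg_sub, deg_add, deg_single, deg_single]; linarith)]
  simp only [deg_sub, deg_add, deg_single]
  ring

lemma InitiallyZero.dualWeight {W : (Fin n → ℤ) → ℤ} (h : InitiallyZero W) (L : Fin n → ℤ) :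
    EventuallyZero (dualWeight W L) := by
  obtain ⟨a, ha⟩ := h
  exact ⟨deg L - a, fun d hd => ha _ (by rw [deg_sub]; linarith)⟩

lemma EventuallyZero.dualWeight {W : (Fin n → ℤ) → ℤ} (h : EventuallyZero W) (L : Fin n → ℤ) :
    InitiallyZero (dualWeight W L) := by
  obtain ⟨b, hb⟩ := h
  exact ⟨deg L - b, fun d hd => hb _ (by rw [deg_sub]; linarith)⟩

end RiemannLemmas

/-! ### Formal differences -/

/-- A notion of objects (vector spaces, diagrams, …) with isomorphisms and binary direct sums. -/
class HasIsoSum (α : Type v) where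
  Iso : α → α → Prop
  sum : α → α → α
  iso_equivalence : Equivalence Iso
  sum_congr : ∀ {a a' b b'}, Iso a a' → Iso b b' → Iso (sum a b) (sum a' b')
  sum_comm : ∀ a b, Iso (sum a b) (sum b a)
  sum_assoc : ∀ a b c, Iso (sum (sum a b) c) (sum a (sum b c))

namespace HasIsoSum

variable {α : Type v} [HasIsoSum α]

/-- `(F₁, F₂) ∼ (F₁', F₂')` iff `F₁ ⊕ F₂' ⊕ F₀ ≃ F₁' ⊕ F₂ ⊕ F₀` for some `F₀`. -/
def VirtualRel (x y : α × α) : Prop :=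
  ∃ c : α, Iso (sum (sum x.1 y.2) c) (sum (sum y.1 x.2) c)

lemma virtualRel_equivalence : Equivalence (VirtualRel (α := α)) := by
  let S : Setoid α := ⟨Iso, iso_equivalence⟩
  let q : α → Quotient S := Quotient.mk S
  let add : Quotient S → Quotient S → Quotient S :=
    Quotient.map₂ sum (fun _ _ h _ _ h' => sum_congr h h')
  have hadd : ∀ a b, q (sum a b) = add (q a) (q b) := fun a b => rfl
  have : Std.Commutative add := ⟨fun a b => by
    induction a using Quotient.inductionOn
    induction b using Quotient.inductionOn
    exact Quotient.sound (sum_comm _ _)⟩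
  have : Std.Associative add := ⟨fun a b c => by
    induction a using Quotient.inductionOn
    induction b using Quotient.inductionOn
    induction c using Quotient.inductionOn
    exact Quotient.sound (sum_assoc _ _ _)⟩
  have hiff : ∀ a b, Iso a b ↔ q a = q b := fun a b =>
    ⟨fun h => Quotient.sound h, fun h => Quotient.exact h⟩
  refine ⟨fun x => ⟨x.1, iso_equivalence.refl _⟩, ?_, ?_⟩
  · rintro x y ⟨c, h⟩
    exact ⟨c, iso_equivalence.symm h⟩
  · rintro x y z ⟨c, h⟩ ⟨c', h'⟩
    refine ⟨sum (sum y.1 y.2) (sum c c'), ?_⟩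
    rw [hiff] at *
    simp only [hadd] at *
    calc _ = add (add (add (q x.1) (q y.2)) (q c)) (add (add (q y.1) (q z.2)) (q c')) := by
          ac_rfl
      _ = add (add (add (q y.1) (q x.2)) (q c)) (add (add (q z.1) (q y.2)) (q c')) := by
          rw [h, h']
      _ = _ := by ac_rfl

/-- The equivalence of formal differences. -/
def virtualSetoid (α : Type v) [HasIsoSum α] : Setoid (α × α) :=
  ⟨VirtualRel, virtualRel_equivalence⟩

end HasIsoSum

/-- Equivalence classes of virtual objects (formal differences `F₁ ⊖ F₂`). -/
def Virtual (α : Type v) [HasIsoSum α] : Type v := Quotient (HasIsoSum.virtualSetoid α)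

namespace Virtual

open HasIsoSum

variable {α β : Type*} [HasIsoSum α] [HasIsoSum β]

/-- The class `[F₁ ⊖ F₂]`. -/
def mk (F₁ F₂ : α) : Virtual α := Quotient.mk (virtualSetoid α) (F₁, F₂)

/-- An operation `h` that respects isomorphisms and direct sums extends to classes by
`h [F₁ ⊖ F₂] = [h F₁ ⊖ h F₂]`. -/
def map (h : α → β) (hiso : ∀ a b, Iso a b → Iso (h a) (h b))
    (hsum : ∀ a b, Iso (h (HasIsoSum.sum a b)) (HasIsoSum.sum (h a) (h b))) :
    Virtual α → Virtual β :=
  Quotient.map' (s₁ := virtualSetoid α) (s₂ := virtualSetoid β) (fun x => (h x.1, h x.2)) (by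
    rintro x y ⟨c, hc⟩
    have E := iso_equivalence (α := β)
    have e : ∀ a b c : α, Iso (h (HasIsoSum.sum (HasIsoSum.sum a b) c))
        (HasIsoSum.sum (HasIsoSum.sum (h a) (h b)) (h c)) := fun a b c =>
      E.trans (hsum _ _) (sum_congr (hsum _ _) (E.refl _))
    exact ⟨h c, E.trans (E.symm (e _ _ _)) (E.trans (hiso _ _ hc) (e _ _ _))⟩)

end Virtual

/-! ### Virtual vector spaces -/

section VirtualVectorSpaces

variable {k : Type u} [Field k]

noncomputable instance : HasIsoSum (FGModuleCat.{u} k) where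
  Iso V W := Nonempty (V ≃ₗ[k] W)
  sum V W := FGModuleCat.of k (V × W)
  iso_equivalence := ⟨fun _ => ⟨LinearEquiv.refl k _⟩, fun ⟨e⟩ => ⟨e.symm⟩,
    fun ⟨e⟩ ⟨e'⟩ => ⟨e.trans e'⟩⟩
  sum_congr := fun ⟨e⟩ ⟨e'⟩ => ⟨LinearEquiv.prodCongr e e'⟩
  sum_comm V W := ⟨LinearEquiv.prodComm k V W⟩
  sum_assoc U V W := ⟨LinearEquiv.prodAssoc k U V W⟩

/-- The dual of a virtual (finite dimensional) vector space: `(V₁ ⊖ V₂)^* = V₁^* ⊖ V₂^*`. -/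
noncomputable def Virtual.dual : Virtual (FGModuleCat.{u} k) → Virtual (FGModuleCat.{u} k) :=
  Virtual.map (fun V => FGModuleCat.of k (Module.Dual k V))
    (fun _ _ ⟨e⟩ => ⟨e.symm.dualMap⟩)
    (fun V W => ⟨(Module.dualProdDualEquivDual k V W).symm⟩)

end VirtualVectorSpaces

/-! ### Diagrams of vector spaces -/

/-- A `k`-diagram: five `k`-vector spaces and four linear maps
`ρ₁₁ : B₁ → A₁`, `ρ₂₂ : B₂ → A₂`, `ρ₃₁ : B₃ → A₁`, `ρ₃₂ : B₃ → A₂`. -/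
structure KDiagram (k : Type u) [Field k] where
  (B₁ B₂ B₃ A₁ A₂ : ModuleCat.{u} k)
  ρ₁₁ : B₁ →ₗ[k] A₁
  ρ₂₂ : B₂ →ₗ[k] A₂
  ρ₃₁ : B₃ →ₗ[k] A₁
  ρ₃₂ : B₃ →ₗ[k] A₂

namespace KDiagram

variable {k : Type u} [Field k]

/-- The differential `∂ (b₁, b₂, b₃) = (ρ₁₁ b₁ - ρ₃₁ b₃, ρ₂₂ b₂ - ρ₃₂ b₃)`. -/
def diff (F : KDiagram k) : (F.B₁ × F.B₂ × F.B₃) →ₗ[k] (F.A₁ × F.A₂) where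
  toFun b := (F.ρ₁₁ b.1 - F.ρ₃₁ b.2.2, F.ρ₂₂ b.2.1 - F.ρ₃₂ b.2.2)
  map_add' x y := by ext <;> simp <;> abel
  map_smul' c x := by ext <;> simp [smul_sub]

/-- The zeroth cohomology group, the kernel of the differential. -/
abbrev H0 (F : KDiagram k) : Submodule k (F.B₁ × F.B₂ × F.B₃) := LinearMap.ker F.diff

/-- The first cohomology group, the cokernel of the differential. -/
abbrev H1 (F : KDiagram k) : Type u := (F.A₁ × F.A₂) ⧸ LinearMap.range F.diff

/-- The diagram has finite Betti numbers. -/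
structure IsFredholm (F : KDiagram k) : Prop where
  finite_H0 : Module.Finite k F.H0
  finite_H1 : Module.Finite k F.H1

/-- An isomorphism of diagrams: invertible linear maps between corresponding values, commuting
with the restriction maps. -/
structure Iso (F G : KDiagram k) where
  φB₁ : F.B₁ ≃ₗ[k] G.B₁
  φB₂ : F.B₂ ≃ₗ[k] G.B₂
  φB₃ : F.B₃ ≃ₗ[k] G.B₃
  φA₁ : F.A₁ ≃ₗ[k] G.A₁
  φA₂ : F.A₂ ≃ₗ[k] G.A₂
  comm₁₁ : ∀ b, G.ρ₁₁ (φB₁ b) = φA₁ (F.ρ₁₁ b)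
  comm₂₂ : ∀ b, G.ρ₂₂ (φB₂ b) = φA₂ (F.ρ₂₂ b)
  comm₃₁ : ∀ b, G.ρ₃₁ (φB₃ b) = φA₁ (F.ρ₃₁ b)
  comm₃₂ : ∀ b, G.ρ₃₂ (φB₃ b) = φA₂ (F.ρ₃₂ b)

/-- The direct sum of two diagrams. -/
def sum (F G : KDiagram k) : KDiagram k where
  B₁ := ModuleCat.of k (F.B₁ × G.B₁)
  B₂ := ModuleCat.of k (F.B₂ × G.B₂)
  B₃ := ModuleCat.of k (F.B₃ × G.B₃)
  A₁ := ModuleCat.of k (F.A₁ × G.A₁)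
  A₂ := ModuleCat.of k (F.A₂ × G.A₂)
  ρ₁₁ := F.ρ₁₁.prodMap G.ρ₁₁
  ρ₂₂ := F.ρ₂₂.prodMap G.ρ₂₂
  ρ₃₁ := F.ρ₃₁.prodMap G.ρ₃₁
  ρ₃₂ := F.ρ₃₂.prodMap G.ρ₃₂

/-- The direct sum of a family of diagrams. -/
abbrev directSum {S : Type} (F : S → KDiagram k) : KDiagram k where
  B₁ := ModuleCat.of k (DirectSum S fun s => (F s).B₁)
  B₂ := ModuleCat.of k (DirectSum S fun s => (F s).B₂)
  B₃ := ModuleCat.of k (DirectSum S fun s => (F s).B₃)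
  A₁ := ModuleCat.of k (DirectSum S fun s => (F s).A₁)
  A₂ := ModuleCat.of k (DirectSum S fun s => (F s).A₂)
  ρ₁₁ := DirectSum.lmap fun s => (F s).ρ₁₁
  ρ₂₂ := DirectSum.lmap fun s => (F s).ρ₂₂
  ρ₃₁ := DirectSum.lmap fun s => (F s).ρ₃₁
  ρ₃₂ := DirectSum.lmap fun s => (F s).ρ₃₂

lemma diff_lof {S : Type} [DecidableEq S] (F : S → KDiagram k) (s : S)
    (b : (F s).B₁ × (F s).B₂ × (F s).B₃) :
    (directSum F).diff (DirectSum.lof k S (fun s => (F s).B₁) s b.1,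
        DirectSum.lof k S (fun s => (F s).B₂) s b.2.1,
        DirectSum.lof k S (fun s => (F s).B₃) s b.2.2) =
      (DirectSum.lof k S (fun s => (F s).A₁) s ((F s).diff b).1,
        DirectSum.lof k S (fun s => (F s).A₂) s ((F s).diff b).2) := by
  refine Prod.ext ?_ ?_
  · change DirectSum.lmap _ _ - DirectSum.lmap _ _ = _
    rw [DirectSum.lmap_lof, DirectSum.lmap_lof, ← map_sub]
    rfl
  · change DirectSum.lmap _ _ - DirectSum.lmap _ _ = _
    rw [DirectSum.lmap_lof, DirectSum.lmap_lof, ← map_sub]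
    rfl

lemma iso_equivalence : Equivalence fun F G : KDiagram k => Nonempty (Iso F G) where
  refl F := ⟨⟨.refl k _, .refl k _, .refl k _, .refl k _, .refl k _,
    fun _ => rfl, fun _ => rfl, fun _ => rfl, fun _ => rfl⟩⟩
  symm := fun {F G} ⟨e⟩ => ⟨⟨e.φB₁.symm, e.φB₂.symm, e.φB₃.symm, e.φA₁.symm, e.φA₂.symm,
    fun b => by rw [LinearEquiv.eq_symm_apply, ← e.comm₁₁, LinearEquiv.apply_symm_apply],
    fun b => by rw [LinearEquiv.eq_symm_apply, ← e.comm₂₂, LinearEquiv.apply_symm_apply],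
    fun b => by rw [LinearEquiv.eq_symm_apply, ← e.comm₃₁, LinearEquiv.apply_symm_apply],
    fun b => by rw [LinearEquiv.eq_symm_apply, ← e.comm₃₂, LinearEquiv.apply_symm_apply]⟩⟩
  trans := fun ⟨e⟩ ⟨e'⟩ => ⟨⟨e.φB₁.trans e'.φB₁, e.φB₂.trans e'.φB₂, e.φB₃.trans e'.φB₃,
    e.φA₁.trans e'.φA₁, e.φA₂.trans e'.φA₂,
    fun b => by simp [e.comm₁₁, e'.comm₁₁], fun b => by simp [e.comm₂₂, e'.comm₂₂],
    fun b => by simp [e.comm₃₁, e'.comm₃₁], fun b => by simp [e.comm₃₂, e'.comm₃₂]⟩⟩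

/-- Direct sum of isomorphisms. -/
def Iso.sumCongr {F F' G G' : KDiagram k} (e : Iso F F') (e' : Iso G G') :
    Iso (F.sum G) (F'.sum G') where
  φB₁ := e.φB₁.prodCongr e'.φB₁
  φB₂ := e.φB₂.prodCongr e'.φB₂
  φB₃ := e.φB₃.prodCongr e'.φB₃
  φA₁ := e.φA₁.prodCongr e'.φA₁
  φA₂ := e.φA₂.prodCongr e'.φA₂
  comm₁₁ b := Prod.ext (e.comm₁₁ b.1) (e'.comm₁₁ b.2)
  comm₂₂ b := Prod.ext (e.comm₂₂ b.1) (e'.comm₂₂ b.2)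
  comm₃₁ b := Prod.ext (e.comm₃₁ b.1) (e'.comm₃₁ b.2)
  comm₃₂ b := Prod.ext (e.comm₃₂ b.1) (e'.comm₃₂ b.2)

/-- Commutativity of the direct sum. -/
def Iso.sumComm (F G : KDiagram k) : Iso (F.sum G) (G.sum F) where
  φB₁ := LinearEquiv.prodComm k _ _
  φB₂ := LinearEquiv.prodComm k _ _
  φB₃ := LinearEquiv.prodComm k _ _
  φA₁ := LinearEquiv.prodComm k _ _
  φA₂ := LinearEquiv.prodComm k _ _
  comm₁₁ _ := rfl
  comm₂₂ _ := rfl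
  comm₃₁ _ := rfl
  comm₃₂ _ := rfl

/-- Associativity of the direct sum. -/
def Iso.sumAssoc (F G E : KDiagram k) : Iso ((F.sum G).sum E) (F.sum (G.sum E)) where
  φB₁ := LinearEquiv.prodAssoc k _ _ _
  φB₂ := LinearEquiv.prodAssoc k _ _ _
  φB₃ := LinearEquiv.prodAssoc k _ _ _
  φA₁ := LinearEquiv.prodAssoc k _ _ _
  φA₂ := LinearEquiv.prodAssoc k _ _ _
  comm₁₁ _ := rfl
  comm₂₂ _ := rfl
  comm₃₁ _ := rfl
  comm₃₂ _ := rfl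

lemma Iso.diff_comm {F G : KDiagram k} (e : Iso F G) (x : F.B₁ × F.B₂ × F.B₃) :
    G.diff (e.φB₁.prodCongr (e.φB₂.prodCongr e.φB₃) x) =
      e.φA₁.prodCongr e.φA₂ (F.diff x) := by
  simp [diff, e.comm₁₁, e.comm₂₂, e.comm₃₁, e.comm₃₂]

/-- Isomorphic diagrams have isomorphic `H⁰`. -/
noncomputable def Iso.h0 {F G : KDiagram k} (e : Iso F G) : F.H0 ≃ₗ[k] G.H0 :=
  (e.φB₁.prodCongr (e.φB₂.prodCongr e.φB₃)).ofSubmodules F.H0 G.H0 (by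
    ext y
    constructor
    · rintro ⟨x, hx, rfl⟩
      have hx' : F.diff x = 0 := hx
      exact (e.diff_comm x).trans (by rw [hx', map_zero])
    · intro hy
      refine ⟨(e.φB₁.prodCongr (e.φB₂.prodCongr e.φB₃)).symm y, ?_,
        LinearEquiv.apply_symm_apply _ y⟩
      have h := e.diff_comm ((e.φB₁.prodCongr (e.φB₂.prodCongr e.φB₃)).symm y)
      rw [LinearEquiv.apply_symm_apply, show G.diff y = 0 from hy] at h
      exact (LinearEquiv.map_eq_zero_iff _).1 h.symm)

/-- Isomorphic diagrams have isomorphic `H¹`. -/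
noncomputable def Iso.h1 {F G : KDiagram k} (e : Iso F G) : F.H1 ≃ₗ[k] G.H1 :=
  Submodule.Quotient.equiv _ _ (e.φA₁.prodCongr e.φA₂) (by
    ext y
    constructor
    · rintro ⟨_, ⟨x, rfl⟩, rfl⟩
      exact ⟨_, e.diff_comm x⟩
    · rintro ⟨x, rfl⟩
      refine ⟨_, ⟨(e.φB₁.prodCongr (e.φB₂.prodCongr e.φB₃)).symm x, rfl⟩, ?_⟩
      have h := e.diff_comm ((e.φB₁.prodCongr (e.φB₂.prodCongr e.φB₃)).symm x)
      rw [LinearEquiv.apply_symm_apply] at h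
      exact h.symm)

/-- `H⁰(F ⊕ G) ≃ H⁰(F) ⊕ H⁰(G)`. -/
def h0Sum (F G : KDiagram k) : (F.sum G).H0 ≃ₗ[k] F.H0 × G.H0 where
  toFun x := (⟨(x.1.1.1, x.1.2.1.1, x.1.2.2.1), by
      have h := x.2
      exact Prod.ext (congrArg (fun z => z.1.1) h) (congrArg (fun z => z.2.1) h)⟩,
    ⟨(x.1.1.2, x.1.2.1.2, x.1.2.2.2), by
      have h := x.2
      exact Prod.ext (congrArg (fun z => z.1.2) h) (congrArg (fun z => z.2.2) h)⟩)
  map_add' _ _ := rfl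
  map_smul' _ _ := rfl
  invFun y := ⟨((y.1.1.1, y.2.1.1), (y.1.1.2.1, y.2.1.2.1), (y.1.1.2.2, y.2.1.2.2)), by
    have h := y.1.2
    have h' := y.2.2
    exact Prod.ext
      (Prod.ext (congrArg (fun z => z.1) h) (congrArg (fun z => z.1) h'))
      (Prod.ext (congrArg (fun z => z.2) h) (congrArg (fun z => z.2) h'))⟩
  left_inv _ := rfl
  right_inv _ := rfl

/-- `H¹(F ⊕ G) ≃ H¹(F) ⊕ H¹(G)`. -/
noncomputable def h1Sum (F G : KDiagram k) : (F.sum G).H1 ≃ₗ[k] F.H1 × G.H1 :=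
  LinearEquiv.ofBijective
    (Submodule.liftQ (LinearMap.range (F.sum G).diff)
      (((LinearMap.range F.diff).mkQ.prodMap (LinearMap.range G.diff).mkQ).comp
        (LinearEquiv.prodProdProdComm k F.A₁ G.A₁ F.A₂ G.A₂).toLinearMap) (by
          rintro _ ⟨x, rfl⟩
          refine Prod.ext ?_ ?_
          · exact (Submodule.Quotient.mk_eq_zero _).2 ⟨(x.1.1, x.2.1.1, x.2.2.1), rfl⟩
          · exact (Submodule.Quotient.mk_eq_zero _).2 ⟨(x.1.2, x.2.1.2, x.2.2.2), rfl⟩))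
    (by
      constructor
      · rw [injective_iff_map_eq_zero]
        intro z
        induction z using Submodule.Quotient.induction_on with
        | _ a =>
          intro h
          obtain ⟨⟨b₁, b₂, b₃⟩, hb⟩ :=
            (Submodule.Quotient.mk_eq_zero _).1 (congrArg Prod.fst h)
          obtain ⟨⟨c₁, c₂, c₃⟩, hc⟩ :=
            (Submodule.Quotient.mk_eq_zero _).1 (congrArg Prod.snd h)
          refine (Submodule.Quotient.mk_eq_zero _).2 ⟨((b₁, c₁), (b₂, c₂), (b₃, c₃)), ?_⟩
          exact Prod.ext
            (Prod.ext (congrArg (fun z => z.1) hb) (congrArg (fun z => z.1) hc))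
            (Prod.ext (congrArg (fun z => z.2) hb) (congrArg (fun z => z.2) hc))
      · rintro ⟨x, y⟩
        induction x using Submodule.Quotient.induction_on with
        | _ a =>
          induction y using Submodule.Quotient.induction_on with
          | _ b => exact ⟨Submodule.Quotient.mk ((a.1, b.1), (a.2, b.2)), rfl⟩)

lemma IsFredholm.sum {F G : KDiagram k} (hF : F.IsFredholm) (hG : G.IsFredholm) :
    (F.sum G).IsFredholm := by
  have := hF.finite_H0
  have := hF.finite_H1
  have := hG.finite_H0
  have := hG.finite_H1
  exact ⟨Module.Finite.equiv (h0Sum F G).symm, Module.Finite.equiv (h1Sum F G).symm⟩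

end KDiagram

/-- Fredholm `k`-diagrams: `k`-diagrams with finite Betti numbers. -/
def FredholmDiagram (k : Type u) [Field k] : Type (u + 1) :=
  {F : KDiagram k // F.IsFredholm}

noncomputable instance (k : Type u) [Field k] : HasIsoSum (FredholmDiagram k) where
  Iso F G := Nonempty (KDiagram.Iso F.1 G.1)
  sum F G := ⟨F.1.sum G.1, F.2.sum G.2⟩
  iso_equivalence := ⟨fun F => KDiagram.iso_equivalence.refl F.1,
    fun h => KDiagram.iso_equivalence.symm h, fun h h' => KDiagram.iso_equivalence.trans h h'⟩
  sum_congr := fun ⟨e⟩ ⟨e'⟩ => ⟨e.sumCongr e'⟩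
  sum_comm F G := ⟨KDiagram.Iso.sumComm F.1 G.1⟩
  sum_assoc F G E := ⟨KDiagram.Iso.sumAssoc F.1 G.1 E.1⟩

namespace FredholmDiagram

variable {k : Type u} [Field k]

/-- `H⁰` of a Fredholm diagram, as a finite dimensional vector space. -/
noncomputable def H0 (F : FredholmDiagram k) : FGModuleCat.{u} k :=
  haveI := F.2.finite_H0
  FGModuleCat.of k F.1.H0

/-- `H¹` of a Fredholm diagram, as a finite dimensional vector space. -/
noncomputable def H1 (F : FredholmDiagram k) : FGModuleCat.{u} k :=
  haveI := F.2.finite_H1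
  FGModuleCat.of k F.1.H1

end FredholmDiagram

namespace Virtual

variable {k : Type u} [Field k]

/-- `H⁰` of a class of virtual diagrams, `H⁰ [F₁ ⊖ F₂] = [H⁰ F₁ ⊖ H⁰ F₂]`. -/
noncomputable def H0 : Virtual (FredholmDiagram k) → Virtual (FGModuleCat.{u} k) :=
  Virtual.map FredholmDiagram.H0 (fun _ _ ⟨e⟩ => ⟨e.h0⟩)
    (fun F G => ⟨KDiagram.h0Sum F.1 G.1⟩)

/-- `H¹` of a class of virtual diagrams, `H¹ [F₁ ⊖ F₂] = [H¹ F₁ ⊖ H¹ F₂]`. -/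
noncomputable def H1 : Virtual (FredholmDiagram k) → Virtual (FGModuleCat.{u} k) :=
  Virtual.map FredholmDiagram.H1 (fun _ _ ⟨e⟩ => ⟨e.h1⟩)
    (fun F G => ⟨KDiagram.h1Sum F.1 G.1⟩)

end Virtual

/-! ### The diagrams attached to weights -/

/-- The multiset with multiplicities `W ≥ 0`: the pairs `(a, i)` with `1 ≤ i ≤ W a`. -/
abbrev Multi (W : (Fin 2 → ℤ) → ℤ) : Type :=
  {p : (Fin 2 → ℤ) × ℕ // 1 ≤ p.2 ∧ (p.2 : ℤ) ≤ W p.1}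

section Models

variable (k : Type u) [Field k]

/-- The diagram `M_{W,d}` of `W : ℤ² → ℤ_{≥ 0}` and `d ∈ ℤ²`: its values are
`B_i = k^{⊕ ℤ_{≤ d_i}}`, `A_i = k^{⊕ ℤ}`, `B₃ = k^{⊕ W}`; the maps `ρ_{ii}` are the
inclusions and the maps `ρ_{3i}` are induced by the projections. -/
noncomputable abbrev matchingDiagram (W : (Fin 2 → ℤ) → ℤ) (d : Fin 2 → ℤ) : KDiagram k where
  B₁ := ModuleCat.of k ({x : ℤ // x ≤ d 0} →₀ k)
  B₂ := ModuleCat.of k ({x : ℤ // x ≤ d 1} →₀ k)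
  B₃ := ModuleCat.of k (Multi W →₀ k)
  A₁ := ModuleCat.of k (ℤ →₀ k)
  A₂ := ModuleCat.of k (ℤ →₀ k)
  ρ₁₁ := Finsupp.lmapDomain k k Subtype.val
  ρ₂₂ := Finsupp.lmapDomain k k Subtype.val
  ρ₃₁ := Finsupp.lmapDomain k k fun p => p.1.1 0
  ρ₃₂ := Finsupp.lmapDomain k k fun p => p.1.1 1

/-- The indicator diagram `I_{d ≥ a}`: its values at `B₃, A₁, A₂` are `k`, its value at `B_i` is
`k` if `a_i ≤ d_i` and `0` otherwise, and its maps are identities and inclusions. -/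
noncomputable abbrev indicatorDiagram (a d : Fin 2 → ℤ) : KDiagram k where
  B₁ := ModuleCat.of k (if a 0 ≤ d 0 then ⊤ else ⊥ : Submodule k k)
  B₂ := ModuleCat.of k (if a 1 ≤ d 1 then ⊤ else ⊥ : Submodule k k)
  B₃ := ModuleCat.of k k
  A₁ := ModuleCat.of k k
  A₂ := ModuleCat.of k k
  ρ₁₁ := Submodule.subtype _
  ρ₂₂ := Submodule.subtype _
  ρ₃₁ := LinearMap.id
  ρ₃₂ := LinearMap.id

/-- The direct sum of indicator diagrams `I_d^{⊕ W} = ⨁_a (I_{d ≥ a})^{⊕ W a}` for `W ≥ 0`. -/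
noncomputable def indicatorSum (W : (Fin 2 → ℤ) → ℤ) (d : Fin 2 → ℤ) : KDiagram k :=
  KDiagram.directSum fun s : Multi W => indicatorDiagram k s.1.1 d

variable {k}

/-- The kernel of the differential of a sum of indicator diagrams is finite dimensional when
only finitely many summands equal the constant diagram. -/
lemma finite_H0_indicator {S : Type} (a : S → Fin 2 → ℤ) (d : Fin 2 → ℤ)
    (hfin : {s | a s ≤ d}.Finite) :
    Module.Finite k (KDiagram.directSum fun s => indicatorDiagram k (a s) d).H0 := by
  have := hfin.to_subtype
  let F := KDiagram.directSum fun s => indicatorDiagram k (a s) d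
  have key : ∀ x : F.H0, ∀ s, ((x.1.1 s).1 : k) = x.1.2.2 s ∧ ((x.1.2.1 s).1 : k) = x.1.2.2 s := by
    intro x s
    have h : F.diff x.1 = 0 := x.2
    exact ⟨sub_eq_zero.1 (DFunLike.congr_fun (congrArg Prod.fst h) s),
      sub_eq_zero.1 (DFunLike.congr_fun (congrArg Prod.snd h) s)⟩
  let g : F.H0 →ₗ[k] ({s | a s ≤ d} → k) :=
    { toFun := fun x t => x.1.2.2 t.1
      map_add' := fun _ _ => rfl
      map_smul' := fun _ _ => rfl }
  refine Module.Finite.of_injective g ((injective_iff_map_eq_zero g).2 fun x hx => ?_)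
  have h3 : ∀ s, (x.1.2.2 s : k) = 0 := by
    intro s
    by_cases hs : a s ≤ d
    · exact congrFun hx ⟨s, hs⟩
    · rw [Pi.le_def, Fin.forall_fin_two, not_and_or] at hs
      rcases hs with hs | hs
      · rw [← (key x s).1]
        have hm : (if a s 0 ≤ d 0 then ⊤ else ⊥ : Submodule k k) = ⊥ := if_neg hs
        exact (Submodule.mem_bot k).1 (hm.le (x.1.1 s).2)
      · rw [← (key x s).2]
        have hm : (if a s 1 ≤ d 1 then ⊤ else ⊥ : Submodule k k) = ⊥ := if_neg hs
        exact (Submodule.mem_bot k).1 (hm.le (x.1.2.1 s).2)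
  refine Subtype.ext (Prod.ext ?_ (Prod.ext ?_ ?_))
  · exact DFinsupp.ext fun s => Subtype.ext ((key x s).1.trans (h3 s))
  · exact DFinsupp.ext fun s => Subtype.ext ((key x s).2.trans (h3 s))
  · exact DFinsupp.ext fun s => h3 s

/-- The cokernel of the differential of a sum of indicator diagrams is finite dimensional when
only finitely many summands vanish at both `B₁` and `B₂`. -/
lemma finite_H1_indicator {S : Type} (a : S → Fin 2 → ℤ) (d : Fin 2 → ℤ)
    (hfin : {s | d + 1 ≤ a s}.Finite) :
    Module.Finite k (KDiagram.directSum fun s => indicatorDiagram k (a s) d).H1 := by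
  classical
  let F := KDiagram.directSum fun s => indicatorDiagram k (a s) d
  let q := (LinearMap.range F.diff).mkQ
  let e₁ : (s : S) → k →ₗ[k] F.H1 := fun s =>
    q ∘ₗ LinearMap.inl k F.A₁ F.A₂ ∘ₗ DirectSum.lof k S (fun _ => k) s
  let e₂ : (s : S) → k →ₗ[k] F.H1 := fun s =>
    q ∘ₗ LinearMap.inr k F.A₁ F.A₂ ∘ₗ DirectSum.lof k S (fun _ => k) s
  have hq : ∀ s (b : (indicatorDiagram k (a s) d).B₁ × (indicatorDiagram k (a s) d).B₂ ×
      (indicatorDiagram k (a s) d).B₃),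
      e₁ s ((indicatorDiagram k (a s) d).diff b).1 +
        e₂ s ((indicatorDiagram k (a s) d).diff b).2 = 0 := by
    intro s b
    have h := (Submodule.Quotient.mk_eq_zero (LinearMap.range F.diff)).2
      ⟨_, KDiagram.diff_lof (fun s => indicatorDiagram k (a s) d) s b⟩
    refine Eq.trans ?_ h
    refine (map_add q _ _).symm.trans (congrArg q (Prod.ext ?_ ?_))
    · exact add_zero _
    · exact zero_add _
  have h3 : ∀ s x, e₁ s x + e₂ s x = 0 := by
    intro s x
    have h := hq s (0, 0, -x)
    simpa [KDiagram.diff] using h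
  have h1 : ∀ s x, a s 0 ≤ d 0 → e₁ s x = 0 := by
    intro s x hs
    have h := hq s (⟨x, by rw [if_pos hs]; trivial⟩, 0, 0)
    simpa [KDiagram.diff] using h
  have h2 : ∀ s x, a s 1 ≤ d 1 → e₂ s x = 0 := by
    intro s x hs
    have h := hq s (0, ⟨x, by rw [if_pos hs]; trivial⟩, 0)
    simpa [KDiagram.diff] using h
  let V : Submodule k F.H1 := Submodule.span k ((fun s => e₁ s 1) '' {s | d + 1 ≤ a s})
  have hV : ∀ s x, e₁ s x ∈ V := by
    intro s x
    by_cases hs : d + 1 ≤ a s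
    · have : e₁ s x = x • e₁ s 1 := by rw [← map_smul, smul_eq_mul, mul_one]
      rw [this]
      exact V.smul_mem _ (Submodule.subset_span ⟨s, hs, rfl⟩)
    · rw [Pi.le_def, Fin.forall_fin_two, not_and_or] at hs
      have h0 : e₁ s x = 0 := by
        rcases hs with hs | hs
        · exact h1 s x (by simpa [Int.add_one_le_iff] using hs)
        · have := h3 s x
          rwa [h2 s x (by simpa [Int.add_one_le_iff] using hs), add_zero] at this
      rw [h0]
      exact V.zero_mem
  have hV2 : ∀ s x, e₂ s x ∈ V := by
    intro s x
    rw [eq_neg_of_add_eq_zero_right (h3 s x)]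
    exact V.neg_mem (hV s x)
  have hA₁ : ∀ y : F.A₁, q (y, 0) ∈ V := by
    intro y
    induction y using DirectSum.induction_on with
    | zero => exact (map_zero q).symm ▸ V.zero_mem
    | of s x => exact hV s x
    | add x y hx hy =>
      have := V.add_mem hx hy
      rw [← map_add] at this
      simpa using this
  have hA₂ : ∀ y : F.A₂, q (0, y) ∈ V := by
    intro y
    induction y using DirectSum.induction_on with
    | zero => exact (map_zero q).symm ▸ V.zero_mem
    | of s x => exact hV2 s x
    | add x y hx hy =>
      have := V.add_mem hx hy
      rw [← map_add] at this
      simpa using this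
  refine ⟨⟨(hfin.image fun s => e₁ s 1).toFinset, ?_⟩⟩
  rw [Set.Finite.coe_toFinset, eq_top_iff]
  intro z _
  obtain ⟨⟨y₁, y₂⟩, rfl⟩ := Submodule.mkQ_surjective _ z
  have : ((y₁, y₂) : F.A₁ × F.A₂) = (y₁, 0) + (0, y₂) := by simp
  rw [this, map_add]
  exact V.add_mem (hA₁ y₁) (hA₂ y₂)

lemma finite_multi {W : (Fin 2 → ℤ) → ℤ} {T : Set (Fin 2 → ℤ)} (hT : {a ∈ T | W a ≠ 0}.Finite) :
    {s : Multi W | s.1.1 ∈ T}.Finite := by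
  have h : (⋃ a ∈ {a ∈ T | W a ≠ 0}, ({a} : Set (Fin 2 → ℤ)) ×ˢ Set.Iic (W a).toNat).Finite :=
    hT.biUnion fun a _ => (Set.finite_singleton a).prod (Set.finite_Iic _)
  refine Set.Finite.of_finite_image (f := Subtype.val) (h.subset ?_) Subtype.val_injective.injOn
  rintro _ ⟨⟨⟨a, i⟩, h1, h2⟩, ha, rfl⟩
  simp only at h1 h2 ha
  refine Set.mem_biUnion (x := a) ⟨ha, fun h0 => ?_⟩ ⟨rfl, ?_⟩
  · rw [h0] at h2
    omega
  · have h3 : i ≤ (W a).toNat := by omega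
    exact h3

lemma InitiallyZero.finite_le {W : (Fin 2 → ℤ) → ℤ} (h : InitiallyZero W) (d : Fin 2 → ℤ) :
    {a ∈ {a | a ≤ d} | W a ≠ 0}.Finite := by
  obtain ⟨m, hm⟩ := h
  refine (Set.finite_Icc (fun i => m - deg d + d i) d).subset ?_
  rintro a ⟨ha, hW⟩
  have hdeg : m < deg a := by
    by_contra hc
    exact hW (hm a (not_lt.1 hc))
  have h0 := ha 0
  have h1 := ha 1
  rw [deg, Fin.sum_univ_two] at hdeg
  refine ⟨?_, ha⟩
  rw [Pi.le_def, Fin.forall_fin_two, deg, Fin.sum_univ_two]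
  constructor <;> linarith

lemma EventuallyZero.finite_ge {W : (Fin 2 → ℤ) → ℤ} (h : EventuallyZero W) (d : Fin 2 → ℤ) :
    {a ∈ {a | d + 1 ≤ a} | W a ≠ 0}.Finite := by
  obtain ⟨m, hm⟩ := h
  refine (Set.finite_Icc d (fun i => m - deg d + d i)).subset ?_
  rintro a ⟨ha, hW⟩
  have hdeg : deg a < m := by
    by_contra hc
    exact hW (hm a (not_lt.1 hc))
  have h0 := ha 0
  have h1 := ha 1
  simp only [Pi.add_apply, Pi.one_apply] at h0 h1
  rw [deg, Fin.sum_univ_two] at hdeg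
  constructor
  · rw [Pi.le_def, Fin.forall_fin_two]
    constructor <;> linarith
  · rw [Pi.le_def, Fin.forall_fin_two, deg, Fin.sum_univ_two]
    constructor <;> linarith

lemma indicatorSum_isFredholm {W : (Fin 2 → ℤ) → ℤ} (h : InitiallyZero W)
    (h' : EventuallyZero W) (d : Fin 2 → ℤ) : (indicatorSum k W d).IsFredholm :=
  ⟨finite_H0_indicator (fun s : Multi W => s.1.1) d (finite_multi (h.finite_le d)),
    finite_H1_indicator (fun s : Multi W => s.1.1) d (finite_multi (h'.finite_ge d))⟩

lemma InitiallyZero.comp {n : ℕ} {W : (Fin n → ℤ) → ℤ} (h : InitiallyZero W) (g : ℤ → ℤ)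
    (hg : g 0 = 0) : InitiallyZero fun a => g (W a) := by
  obtain ⟨m, hm⟩ := h
  exact ⟨m, fun d hd => (congrArg g (hm d hd)).trans hg⟩

lemma EventuallyZero.comp {n : ℕ} {W : (Fin n → ℤ) → ℤ} (h : EventuallyZero W) (g : ℤ → ℤ)
    (hg : g 0 = 0) : EventuallyZero fun a => g (W a) := by
  obtain ⟨m, hm⟩ := h
  exact ⟨m, fun d hd => (congrArg g (hm d hd)).trans hg⟩

variable (k) in
/-- The class `[M_{W,d}]` attached to a function `W : ℤ² → ℤ` that is initially and eventually
zero, as the formal difference `I_d^{⊕ W⁺} ⊖ I_d^{⊕ W⁻}` with `W⁺ = max(W, 0)` and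
`W⁻ = max(-W, 0)`. -/
noncomputable def weightModel (W : (Fin 2 → ℤ) → ℤ) (h : InitiallyZero W)
    (h' : EventuallyZero W) (d : Fin 2 → ℤ) : Virtual (FredholmDiagram k) :=
  Virtual.mk
    ⟨indicatorSum k (fun a => max (W a) 0) d,
      indicatorSum_isFredholm (h.comp (max · 0) (by simp)) (h'.comp (max · 0) (by simp)) d⟩
    ⟨indicatorSum k (fun a => max (-W a) 0) d,
      indicatorSum_isFredholm (h.comp (fun x => max (-x) 0) (by simp))
        (h'.comp (fun x => max (-x) 0) (by simp)) d⟩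

variable {n : ℕ} {f : (Fin n → ℤ) → ℤ} {C : ℤ}

variable (k) in
/-- The class `[M_{f;i,j,d}] = [M_{W,0}]` for a Riemann function `f : ℤⁿ → ℤ`, where `W` is the
weight of the two-variable restriction `f_{i,j,d}`. -/
noncomputable def restrictionModel (hf : IsRiemannFunction f C) (i j : Fin n) (d : Fin n → ℤ) :
    Virtual (FredholmDiagram k) :=
  weightModel k (weight (restrictTwo f i j d)) (hf.restrictTwo i j d).weight_initiallyZero
    (hf.restrictTwo i j d).weight_eventuallyZero 0

variable (k) in
/-- The class `[M_{f at d}]` for a Riemann function `f : ℤⁿ → ℤ`, `n ≥ 2`: the class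
`[M_{f;i,j,d}]`, taken at the first two coordinates. -/
noncomputable def modelAt (hn : 2 ≤ n) (hf : IsRiemannFunction f C) (d : Fin n → ℤ) :
    Virtual (FredholmDiagram k) :=
  restrictionModel k hf ⟨0, by omega⟩ ⟨1, by omega⟩ d

/-- The class `c` is represented by the formal difference of diagrams `F₁ ⊖ F₂`
(in particular both diagrams are Fredholm). -/
def RepresentedBy (c : Virtual (FredholmDiagram k)) (F₁ F₂ : KDiagram k) : Prop :=
  ∃ (h₁ : F₁.IsFredholm) (h₂ : F₂.IsFredholm), c = Virtual.mk ⟨F₁, h₁⟩ ⟨F₂, h₂⟩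

variable (k) in
/-- The direct sum `⨁_l M_{P l, d}`. -/
noncomputable abbrev matchingSum {S : Type} (P : S → (Fin 2 → ℤ) → ℤ) (d : Fin 2 → ℤ) :
    KDiagram k :=
  KDiagram.directSum fun l => matchingDiagram k (P l) d

/-- The explicit form of the duality isomorphism `H¹(⨁ M_{P l, d})^* ≃ H⁰(⨁ M_{Q l, e})`
induced by `Hom(k_{/B₁,B₂}, k_{/B₁,B₂}) ≃ Hom(k, k)`, `id ↦ id`, on matching indicator summands
`a ↔ d + e + 1 - a`: a functional `w` on `H¹` goes to the global section whose coefficient at the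
basis vector `m` of the `l`-th summand of `B₁` is the value of `w` on the class of the basis vector
`d₁ + e₁ + 1 - m` of the `l`-th summand of `A₁`. -/
def IsCanonicalDuality {S : Type} [DecidableEq S] {P Q : S → (Fin 2 → ℤ) → ℤ} {d e : Fin 2 → ℤ}
    (φ : Module.Dual k (matchingSum k P d).H1 ≃ₗ[k] (matchingSum k Q e).H0) : Prop :=
  ∀ (w : Module.Dual k (matchingSum k P d).H1) (l : S) (m : {x : ℤ // x ≤ e 0}),
    ((φ w).1.1 l : {x : ℤ // x ≤ e 0} →₀ k) m =
      w (Submodule.Quotient.mk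
        (DirectSum.lof k S (fun _ => ℤ →₀ k) l (Finsupp.single (d 0 + e 0 + 1 - m) 1), 0))

/-- The duality isomorphisms `H¹(⨁ M_{P l, d})^* ≃ H⁰(⨁ M_{Q l, e})` (the canonical one) and
`H⁰(⨁ M_{P l, d})^* ≃ H¹(⨁ M_{Q l, e})` (the transpose of the canonical one with the roles of
`P, d` and `Q, e` exchanged) exist. -/
def HaveCanonicalDualities (k : Type u) [Field k] {S : Type} [DecidableEq S]
    (P Q : S → (Fin 2 → ℤ) → ℤ) (d e : Fin 2 → ℤ) : Prop :=
  ∃ (φ : Module.Dual k (matchingSum k P d).H1 ≃ₗ[k] (matchingSum k Q e).H0)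
    (φ' : Module.Dual k (matchingSum k Q e).H1 ≃ₗ[k] (matchingSum k P d).H0)
    (ψ : Module.Dual k (matchingSum k P d).H0 ≃ₗ[k] (matchingSum k Q e).H1),
    IsCanonicalDuality φ ∧ IsCanonicalDuality φ' ∧
      ∀ (u : Module.Dual k (matchingSum k P d).H0) (w : Module.Dual k (matchingSum k Q e).H1),
        w (ψ u) = u (φ' w)

end Models

/-! Every diagram in play splits into indicator diagrams: it is isomorphic to some
`KDiagram.ofPredicates` on a countable set, whose elements each give a line at `B₃`, `A₁`, `A₂` and,
according to two predicates, at `B₁` and `B₂`. Elements satisfying both predicates index a basis of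
`H⁰`, those satisfying neither a basis of `H¹`, and the two mixed kinds are acyclic. Equivalence of
virtual diagrams allows a common Fredholm summand; infinitely many copies of both acyclic kinds form
such a summand and absorb all other acyclic pieces (`KDiagram.HasType.nonempty_iso_sum`). Hence a
class is determined by two integers, the signed numbers of summands contributing to `H⁰` and to `H¹`
(`HasVirtualType.eq`).

For a weight `W` at `d` these integers are the sums of `W` over the quadrants `a ≤ d` and `a ≥ d +
1`. When `W = 𝔪 g` they telescope to `g d` and `g d - deg d - C`. For the restriction of `f` to any
two coordinates through `d` this gives `f d` and `f d - deg d - C`, with no trace of `i, j`. The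
`K`-dual at `K - d` has the same two numbers exchanged, as does the weight reflected by `a ↦ L - a`,
which exchanges the quadrants. The virtual duality is then an equality of dimensions.

For sums of perfect matchings, `H¹` at `δ` has a basis of matched pairs above `δ`, and reflection
carries these to the pairs below `κ - δ`, which index a basis of the dual `H⁰`. The stated formula
defines an injection between spaces of equal dimension (`exists_isCanonicalDuality`).

A bounded weight is decomposed by subtracting `max (deg + C) 0`, whose weight is an antidiagonal.
What remains is the weight of a bounded function supported on a band of degrees. It is cut into
indicator functions of sets lying on one antidiagonal without adjacent points, and the weight of
each of these is a perfect matching minus an antidiagonal (`weight_level_mem`). -/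

theorem DFinsupp.basis_apply {ι R : Type*} {M : ι → Type*} [DecidableEq ι] [Semiring R]
    [∀ i, AddCommMonoid (M i)] [∀ i, Module R (M i)] {η : ι → Type*}
    (b : ∀ i, Module.Basis (η i) R (M i)) (x : Σ i, η i) :
    DFinsupp.basis b x = DFinsupp.single x.1 (b x.1 x.2) := by
  obtain ⟨i, j⟩ := x
  rw [Module.Basis.apply_eq_iff]
  ext ⟨i', j'⟩
  change (b i').repr ((DFinsupp.single i (b i j)) i') j' = _
  by_cases h : i = i'
  · subst h
    simp [Finsupp.single_apply_left sigma_mk_injective]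
  · rw [DFinsupp.single_eq_of_ne (Ne.symm h), Finsupp.single_eq_of_ne]
    · simp
    · rintro h'
      exact h (congrArg Sigma.fst h').symm

/-! ### Normal form of diagrams: sums of indicator diagrams. -/

namespace KDiagram

variable {k : Type u} [Field k]

variable (k) in
/-- The diagram with free values on the set `S` at `B₃`, `A₁`, `A₂` and on the subsets cut out by
`p₁`, `p₂` at `B₁`, `B₂`, with inclusions and identities as maps. -/
noncomputable abbrev ofPredicates {S : Type} (p₁ p₂ : S → Prop) : KDiagram k where
  B₁ := ModuleCat.of k ({s // p₁ s} →₀ k)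
  B₂ := ModuleCat.of k ({s // p₂ s} →₀ k)
  B₃ := ModuleCat.of k (S →₀ k)
  A₁ := ModuleCat.of k (S →₀ k)
  A₂ := ModuleCat.of k (S →₀ k)
  ρ₁₁ := Finsupp.lmapDomain k k Subtype.val
  ρ₂₂ := Finsupp.lmapDomain k k Subtype.val
  ρ₃₁ := LinearMap.id
  ρ₃₂ := LinearMap.id

/-- A diagram whose values have bases that are compatible with its maps. -/
noncomputable def Iso.ofBases {F : KDiagram k} {S : Type} {p₁ p₂ : S → Prop}
    (b₁ : Module.Basis {s // p₁ s} k F.B₁) (b₂ : Module.Basis {s // p₂ s} k F.B₂)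
    (b₃ : Module.Basis S k F.B₃) (c₁ : Module.Basis S k F.A₁) (c₂ : Module.Basis S k F.A₂)
    (h₁₁ : ∀ s, F.ρ₁₁ (b₁ s) = c₁ s) (h₂₂ : ∀ s, F.ρ₂₂ (b₂ s) = c₂ s)
    (h₃₁ : ∀ s, F.ρ₃₁ (b₃ s) = c₁ s) (h₃₂ : ∀ s, F.ρ₃₂ (b₃ s) = c₂ s) :
    Iso F (ofPredicates k p₁ p₂) where
  φB₁ := b₁.repr
  φB₂ := b₂.repr
  φB₃ := b₃.repr
  φA₁ := c₁.repr
  φA₂ := c₂.repr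
  comm₁₁ b := LinearMap.congr_fun (f := Finsupp.lmapDomain k k Subtype.val ∘ₗ b₁.repr.toLinearMap)
    (g := c₁.repr.toLinearMap ∘ₗ F.ρ₁₁) (b₁.ext fun s => by simp [h₁₁]) b
  comm₂₂ b := LinearMap.congr_fun (f := Finsupp.lmapDomain k k Subtype.val ∘ₗ b₂.repr.toLinearMap)
    (g := c₂.repr.toLinearMap ∘ₗ F.ρ₂₂) (b₂.ext fun s => by simp [h₂₂]) b
  comm₃₁ b := LinearMap.congr_fun (f := b₃.repr.toLinearMap)
    (g := c₁.repr.toLinearMap ∘ₗ F.ρ₃₁) (b₃.ext fun s => by simp [h₃₁]) b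
  comm₃₂ b := LinearMap.congr_fun (f := b₃.repr.toLinearMap)
    (g := c₂.repr.toLinearMap ∘ₗ F.ρ₃₂) (b₃.ext fun s => by simp [h₃₂]) b

/-- Direct sum of a family of isomorphisms. -/
noncomputable def Iso.directSumCongr {S : Type} {F G : S → KDiagram k} (e : ∀ s, Iso (F s) (G s)) :
    Iso (directSum F) (directSum G) where
  φB₁ := DFinsupp.mapRange.linearEquiv fun s => (e s).φB₁
  φB₂ := DFinsupp.mapRange.linearEquiv fun s => (e s).φB₂
  φB₃ := DFinsupp.mapRange.linearEquiv fun s => (e s).φB₃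
  φA₁ := DFinsupp.mapRange.linearEquiv fun s => (e s).φA₁
  φA₂ := DFinsupp.mapRange.linearEquiv fun s => (e s).φA₂
  comm₁₁ b := DFinsupp.ext fun s => (e s).comm₁₁ (b s)
  comm₂₂ b := DFinsupp.ext fun s => (e s).comm₂₂ (b s)
  comm₃₁ b := DFinsupp.ext fun s => (e s).comm₃₁ (b s)
  comm₃₂ b := DFinsupp.ext fun s => (e s).comm₃₂ (b s)

/-- A relabelling of the index set of `ofPredicates`. -/
noncomputable def Iso.ofPredicatesCongr {S S' : Type} {p₁ p₂ : S → Prop} {p₁' p₂' : S' → Prop}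
    (e : S ≃ S') (h₁ : ∀ s, p₁ s ↔ p₁' (e s)) (h₂ : ∀ s, p₂ s ↔ p₂' (e s)) :
    Iso (ofPredicates k p₁ p₂) (ofPredicates k p₁' p₂') :=
  Iso.ofBases (Finsupp.basisSingleOne.reindex (e.subtypeEquiv h₁))
    (Finsupp.basisSingleOne.reindex (e.subtypeEquiv h₂)) (Finsupp.basisSingleOne.reindex e)
    (Finsupp.basisSingleOne.reindex e) (Finsupp.basisSingleOne.reindex e)
    (fun s => by simp) (fun s => by simp) (fun s => by simp) (fun s => by simp)

/-- A direct sum of diagrams `ofPredicates` is of this form. -/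
noncomputable def Iso.directSumOfPredicates {L : Type} {S : L → Type} (p₁ p₂ : ∀ l, S l → Prop) :
    Iso (directSum fun l => ofPredicates k (p₁ l) (p₂ l))
      (ofPredicates k (fun x : Σ l, S l => p₁ x.1 x.2) (fun x : Σ l, S l => p₂ x.1 x.2)) := by
  classical
  let e (p : ∀ l, S l → Prop) : (Σ l, {s // p l s}) ≃ {x : Σ l, S l // p x.1 x.2} :=
    ⟨fun x => ⟨⟨x.1, x.2.1⟩, x.2.2⟩, fun x => ⟨x.1.1, x.1.2, x.2⟩, fun _ => rfl, fun _ => rfl⟩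
  refine Iso.ofBases
    ((DFinsupp.basis fun l => Finsupp.basisSingleOne).reindex (e p₁))
    ((DFinsupp.basis fun l => Finsupp.basisSingleOne).reindex (e p₂))
    (DFinsupp.basis fun l => Finsupp.basisSingleOne)
    (DFinsupp.basis fun l => Finsupp.basisSingleOne)
    (DFinsupp.basis fun l => Finsupp.basisSingleOne) ?_ ?_ ?_ ?_
  · rintro ⟨⟨l, s⟩, hs⟩
    rw [Module.Basis.reindex_apply, DFinsupp.basis_apply, DFinsupp.basis_apply]
    refine (DirectSum.lmap_lof _ _ _).trans ?_
    simp [e, DirectSum.lof, DFinsupp.lsingle]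
  · rintro ⟨⟨l, s⟩, hs⟩
    rw [Module.Basis.reindex_apply, DFinsupp.basis_apply, DFinsupp.basis_apply]
    refine (DirectSum.lmap_lof _ _ _).trans ?_
    simp [e, DirectSum.lof, DFinsupp.lsingle]
  · intro s
    exact DFinsupp.ext fun _ => rfl
  · intro s
    exact DFinsupp.ext fun _ => rfl

/-- The direct sum of two diagrams `ofPredicates` is of this form. -/
noncomputable def Iso.sumOfPredicates {S S' : Type} (p₁ p₂ : S → Prop) (p₁' p₂' : S' → Prop) :
    Iso ((ofPredicates k p₁ p₂).sum (ofPredicates k p₁' p₂'))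
      (ofPredicates k (Sum.elim p₁ p₁') (Sum.elim p₂ p₂')) := by
  let e (p : S → Prop) (p' : S' → Prop) : {s // p s} ⊕ {s // p' s} ≃ {x // Sum.elim p p' x} :=
    (Equiv.subtypeSum (p := Sum.elim p p')).symm
  have key (p : S → Prop) (p' : S' → Prop) (x : {x // Sum.elim p p' x}) :
      (Finsupp.lmapDomain k k Subtype.val).prodMap (Finsupp.lmapDomain k k Subtype.val)
        (((Finsupp.basisSingleOne.prod Finsupp.basisSingleOne).reindex (e p p')) x) =
      (Finsupp.basisSingleOne.prod Finsupp.basisSingleOne : Module.Basis (S ⊕ S') k _) x := by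
    obtain ⟨s | s, hs⟩ := x
    all_goals
      rw [Module.Basis.reindex_apply, Module.Basis.prod_apply, Module.Basis.prod_apply]
      refine Prod.ext ?_ ?_ <;> simp [e, Equiv.subtypeSum]
  exact Iso.ofBases
    ((Finsupp.basisSingleOne.prod Finsupp.basisSingleOne).reindex (e p₁ p₁'))
    ((Finsupp.basisSingleOne.prod Finsupp.basisSingleOne).reindex (e p₂ p₂'))
    (Finsupp.basisSingleOne.prod Finsupp.basisSingleOne)
    (Finsupp.basisSingleOne.prod Finsupp.basisSingleOne)
    (Finsupp.basisSingleOne.prod Finsupp.basisSingleOne)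
    (key p₁ p₁') (key p₂ p₂') (fun _ => rfl) (fun _ => rfl)

lemma exists_basis_ite (p : Prop) [Decidable p] :
    ∃ b : Module.Basis {_u : Unit // p} k (if p then ⊤ else ⊥ : Submodule k k),
      ∀ u, (b u : k) = 1 := by
  by_cases h : p
  · let : Unique {_u : Unit // p} := ⟨⟨⟨(), h⟩⟩, fun _ => rfl⟩
    have e : (⊤ : Submodule k k) = if p then ⊤ else ⊥ := (if_pos h).symm
    refine ⟨(Module.Basis.singleton {_u : Unit // p} k).map
      (Submodule.topEquiv.symm.trans (LinearEquiv.ofEq _ _ e)), fun u => ?_⟩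
    simp
  · have e : (if p then ⊤ else ⊥ : Submodule k k) = ⊥ := if_neg h
    have : Subsingleton (if p then ⊤ else ⊥ : Submodule k k) := by
      rw [e]
      infer_instance
    have : IsEmpty {_u : Unit // p} := ⟨fun u => h u.2⟩
    exact ⟨Module.Basis.empty _, fun u => isEmptyElim u⟩

lemma nonempty_iso_indicatorDiagram (a d : Fin 2 → ℤ) :
    Nonempty (Iso (indicatorDiagram k a d)
      (ofPredicates k (fun _ : Unit => a 0 ≤ d 0) (fun _ : Unit => a 1 ≤ d 1))) := by
  obtain ⟨b₁, h₁⟩ := exists_basis_ite (k := k) (a 0 ≤ d 0)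
  obtain ⟨b₂, h₂⟩ := exists_basis_ite (k := k) (a 1 ≤ d 1)
  refine ⟨Iso.ofBases b₁ b₂ (Module.Basis.singleton Unit k) (Module.Basis.singleton Unit k)
    (Module.Basis.singleton Unit k) ?_ ?_ ?_ ?_⟩
  · exact fun s => by simpa using h₁ s
  · exact fun s => by simpa using h₂ s
  · exact fun s => rfl
  · exact fun s => rfl

end KDiagram

/-! ### Cohomology of the normal form, and absorption of acyclic summands. -/

namespace KDiagram

variable {k : Type u} [Field k]

section Cohomology

variable {S : Type} (p₁ p₂ : S → Prop)

/-- `H⁰` of `ofPredicates` is free on the elements that satisfy both predicates. -/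
lemma nonempty_h0_ofPredicates :
    Nonempty (({s // p₁ s ∧ p₂ s} →₀ k) ≃ₗ[k] (ofPredicates k p₁ p₂).H0) := by
  classical
  let i₁ : {s // p₁ s ∧ p₂ s} → {s // p₁ s} := fun s => ⟨s, s.2.1⟩
  let i₂ : {s // p₁ s ∧ p₂ s} → {s // p₂ s} := fun s => ⟨s, s.2.2⟩
  have hv : Function.Injective (Subtype.val : {s // p₁ s ∧ p₂ s} → S) := Subtype.val_injective
  let g : ({s // p₁ s ∧ p₂ s} →₀ k) →ₗ[k] (ofPredicates k p₁ p₂).B₁ ×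
      (ofPredicates k p₁ p₂).B₂ × (ofPredicates k p₁ p₂).B₃ :=
    (Finsupp.lmapDomain k k i₁).prod
      ((Finsupp.lmapDomain k k i₂).prod (Finsupp.lmapDomain k k Subtype.val))
  have hg (x) : g x ∈ (ofPredicates k p₁ p₂).H0 := by
    refine Prod.ext (sub_eq_zero.2 ?_) (sub_eq_zero.2 ?_)
    · exact (Finsupp.mapDomain_comp (v := x) (f := i₁) (g := Subtype.val)).symm
    · exact (Finsupp.mapDomain_comp (v := x) (f := i₂) (g := Subtype.val)).symm
  refine ⟨LinearEquiv.ofBijective (g.codRestrict _ hg) ⟨?_, ?_⟩⟩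
  · intro x y h
    exact Finsupp.mapDomain_injective hv (congrArg (fun z => z.1.2.2) h)
  · rintro ⟨⟨b₁, b₂, b₃⟩, hb⟩
    have h₁ : Finsupp.mapDomain Subtype.val b₁ = b₃ := sub_eq_zero.1 (congrArg Prod.fst hb)
    have h₂ : Finsupp.mapDomain Subtype.val b₂ = b₃ := sub_eq_zero.1 (congrArg Prod.snd hb)
    -- `b₃` comes both from `B₁` and from `B₂`, so its support satisfies both predicates.
    have h₃ : Finsupp.mapDomain Subtype.val (b₃.subtypeDomain fun s => p₁ s ∧ p₂ s) = b₃ := by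
      ext s
      by_cases hs : p₁ s ∧ p₂ s
      · exact Finsupp.mapDomain_apply hv _ ⟨s, hs⟩
      · rw [Finsupp.mapDomain_of_notMem_range _ _ (by simpa using hs)]
        rcases not_and_or.1 hs with hs | hs
        · rw [← h₁, Finsupp.mapDomain_of_notMem_range _ _ (by simpa using hs)]
        · rw [← h₂, Finsupp.mapDomain_of_notMem_range _ _ (by simpa using hs)]
    refine ⟨b₃.subtypeDomain fun s => p₁ s ∧ p₂ s, Subtype.ext (Prod.ext ?_ (Prod.ext ?_ h₃))⟩
    · refine Finsupp.mapDomain_injective Subtype.val_injective ?_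
      exact ((Finsupp.mapDomain_comp (f := i₁) (g := Subtype.val)).symm.trans h₃).trans h₁.symm
    · refine Finsupp.mapDomain_injective Subtype.val_injective ?_
      exact ((Finsupp.mapDomain_comp (f := i₂) (g := Subtype.val)).symm.trans h₃).trans h₂.symm

/-- `H¹` of `ofPredicates` is free on the elements that satisfy neither predicate. -/
lemma nonempty_h1_ofPredicates :
    Nonempty ((ofPredicates k p₁ p₂).H1 ≃ₗ[k] ({s // ¬ p₁ s ∧ ¬ p₂ s} →₀ k)) := by
  classical
  -- The image of `B₃` is the diagonal, so the cokernel only sees `y₁ - y₂`, modulo what `B₁` and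
  -- `B₂` hit.
  let g : (S →₀ k) × (S →₀ k) →ₗ[k] ({s // ¬ p₁ s ∧ ¬ p₂ s} →₀ k) :=
    Finsupp.lsubtypeDomain {s | ¬ p₁ s ∧ ¬ p₂ s} ∘ₗ (LinearMap.fst k _ _ - LinearMap.snd k _ _)
  have hsurj : Function.Surjective g := fun x => by
    refine ⟨(Finsupp.mapDomain Subtype.val x, 0), Finsupp.ext fun s => ?_⟩
    change (Finsupp.mapDomain Subtype.val x - 0) s.1 = x s
    rw [sub_zero, Finsupp.mapDomain_apply Subtype.val_injective]
  have hker : LinearMap.range (ofPredicates k p₁ p₂).diff = LinearMap.ker g := by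
    ext ⟨y₁, y₂⟩
    constructor
    · rintro ⟨⟨b₁, b₂, b₃⟩, hb⟩
      have e₁ : Finsupp.mapDomain Subtype.val b₁ - b₃ = y₁ := congrArg Prod.fst hb
      have e₂ : Finsupp.mapDomain Subtype.val b₂ - b₃ = y₂ := congrArg Prod.snd hb
      refine Finsupp.ext fun s => ?_
      change (y₁ - y₂) s.1 = 0
      rw [← e₁, ← e₂, sub_sub_sub_cancel_right, Finsupp.sub_apply,
        Finsupp.mapDomain_of_notMem_range _ _ (by simpa using s.2.1),
        Finsupp.mapDomain_of_notMem_range _ _ (by simpa using s.2.2), sub_zero]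
    · intro h
      have h0 (s) (h₁ : ¬ p₁ s) (h₂ : ¬ p₂ s) : y₁ s - y₂ s = 0 :=
        DFunLike.congr_fun (show g (y₁, y₂) = 0 from h) ⟨s, h₁, h₂⟩
      have key (q : S → Prop) (z : S →₀ k) (hz : ∀ s, ¬ q s → z s = 0) :
          Finsupp.mapDomain Subtype.val (z.subtypeDomain q) = z := by
        ext s
        by_cases hs : q s
        · exact Finsupp.mapDomain_apply Subtype.val_injective _ (⟨s, hs⟩ : {s // q s})
        · rw [Finsupp.mapDomain_of_notMem_range _ _ (by simpa using hs), hz s hs]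
      -- Split `y₁ - y₂` into its part on `p₁`, lifted to `B₁`, and the rest, which is supported on
      -- `p₂` by `h0` and is lifted to `B₂` with a minus sign; `b₃` is then forced.
      have e₁ := key p₁ ((y₁ - y₂).filter p₁) fun s hs => Finsupp.filter_apply_neg _ _ hs
      have e₂ := key p₂ (-((y₁ - y₂).filter fun s => ¬ p₁ s)) fun s hs => by
        by_cases h₁ : p₁ s
        · simp [h₁]
        · rw [Finsupp.neg_apply, Finsupp.filter_apply_pos (fun s => ¬ p₁ s) _ h₁,
            Finsupp.sub_apply, h0 s h₁ hs, neg_zero]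
      refine ⟨(((y₁ - y₂).filter p₁).subtypeDomain p₁,
        (-((y₁ - y₂).filter fun s => ¬ p₁ s)).subtypeDomain p₂,
        (y₁ - y₂).filter p₁ - y₁), Prod.ext ?_ ?_⟩
      · change Finsupp.mapDomain _ _ - (_ - y₁) = y₁
        rw [e₁, sub_sub_cancel]
      · change Finsupp.mapDomain _ _ - (_ - y₁) = y₂
        rw [e₂, ← neg_add', ← add_sub_assoc, add_comm (Finsupp.filter _ _),
          Finsupp.filter_add_filter_not, sub_sub_cancel_left, neg_neg]
  exact ⟨(Submodule.quotEquivOfEq _ _ hker).trans (g.quotKerEquivOfSurjective hsurj)⟩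

end Cohomology

/-- The diagram `F` is isomorphic to a countable direct sum of indicator diagrams, of which `m` are
constant and `n` vanish at both `B₁` and `B₂`. -/
def HasType (F : KDiagram k) (m n : ℕ) : Prop :=
  ∃ (S : Type) (_ : Countable S) (p₁ p₂ : S → Prop), Nonempty (Iso F (ofPredicates k p₁ p₂)) ∧
    Finite {s // p₁ s ∧ p₂ s} ∧ Finite {s // ¬ p₁ s ∧ ¬ p₂ s} ∧
    Nat.card {s // p₁ s ∧ p₂ s} = m ∧ Nat.card {s // ¬ p₁ s ∧ ¬ p₂ s} = n

variable {F G : KDiagram k} {m n m' n' : ℕ}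

lemma HasType.congr (hF : HasType F m n) (e : Nonempty (Iso G F)) : HasType G m n := by
  obtain ⟨S, hS, p₁, p₂, e', h⟩ := hF
  exact ⟨S, hS, p₁, p₂, iso_equivalence.trans e e', h⟩

lemma HasType.isFredholm (hF : HasType F m n) : F.IsFredholm := by
  obtain ⟨S, hS, p₁, p₂, ⟨e⟩, h₁, h₂, -, -⟩ := hF
  obtain ⟨e₀⟩ := nonempty_h0_ofPredicates (k := k) p₁ p₂
  obtain ⟨e₁⟩ := nonempty_h1_ofPredicates (k := k) p₁ p₂
  exact ⟨Module.Finite.equiv (e₀.trans e.h0.symm), Module.Finite.equiv (e.h1.trans e₁).symm⟩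

lemma HasType.finrank_H0 (hF : HasType F m n) : Module.finrank k F.H0 = m := by
  obtain ⟨S, hS, p₁, p₂, ⟨e⟩, h₁, h₂, rfl, -⟩ := hF
  obtain ⟨e₀⟩ := nonempty_h0_ofPredicates (k := k) p₁ p₂
  have := Fintype.ofFinite {s // p₁ s ∧ p₂ s}
  rw [(e.h0.trans e₀.symm).finrank_eq, Module.finrank_finsupp_self, Nat.card_eq_fintype_card]

lemma HasType.finrank_H1 (hF : HasType F m n) : Module.finrank k F.H1 = n := by
  obtain ⟨S, hS, p₁, p₂, ⟨e⟩, h₁, h₂, -, rfl⟩ := hF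
  obtain ⟨e₁⟩ := nonempty_h1_ofPredicates (k := k) p₁ p₂
  have := Fintype.ofFinite {s // ¬ p₁ s ∧ ¬ p₂ s}
  rw [(e.h1.trans e₁).finrank_eq, Module.finrank_finsupp_self, Nat.card_eq_fintype_card]

lemma HasType.sum (hF : HasType F m n) (hG : HasType G m' n') :
    HasType (F.sum G) (m + m') (n + n') := by
  obtain ⟨S, hS, p₁, p₂, ⟨e⟩, h₁, h₂, rfl, rfl⟩ := hF
  obtain ⟨S', hS', p₁', p₂', ⟨e'⟩, h₁', h₂', rfl, rfl⟩ := hG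
  let a : {x // Sum.elim p₁ p₁' x ∧ Sum.elim p₂ p₂' x} ≃
      {s // p₁ s ∧ p₂ s} ⊕ {s // p₁' s ∧ p₂' s} := Equiv.subtypeSum
  let b : {x // ¬ Sum.elim p₁ p₁' x ∧ ¬ Sum.elim p₂ p₂' x} ≃
      {s // ¬ p₁ s ∧ ¬ p₂ s} ⊕ {s // ¬ p₁' s ∧ ¬ p₂' s} := Equiv.subtypeSum
  exact ⟨S ⊕ S', inferInstance, Sum.elim p₁ p₁', Sum.elim p₂ p₂',
    iso_equivalence.trans ⟨e.sumCongr e'⟩ ⟨Iso.sumOfPredicates _ _ _ _⟩,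
    .of_equiv _ a.symm, .of_equiv _ b.symm,
    by rw [Nat.card_congr a, Nat.card_sum], by rw [Nat.card_congr b, Nat.card_sum]⟩

/-- A countably infinite sum of each of the two kinds of acyclic indicator diagrams. -/
lemma hasType_acyclic : HasType (ofPredicates k (S := ℕ ⊕ ℕ) (fun s => s.isLeft) fun s => s.isRight)
    0 0 := by
  have h₁ : IsEmpty {s : ℕ ⊕ ℕ // s.isLeft = true ∧ s.isRight = true} :=
    ⟨by rintro ⟨s | s, h⟩ <;> simp at h⟩
  have h₂ : IsEmpty {s : ℕ ⊕ ℕ // ¬ s.isLeft = true ∧ ¬ s.isRight = true} :=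
    ⟨by rintro ⟨s | s, h⟩ <;> simp at h⟩
  exact ⟨ℕ ⊕ ℕ, inferInstance, _, _, iso_equivalence.refl _, inferInstance, inferInstance,
    Nat.card_of_isEmpty, Nat.card_of_isEmpty⟩

/-- Diagrams of the same type are isomorphic after adding acyclic summands. -/
lemma HasType.nonempty_iso_sum (hF : HasType F m n) (hG : HasType G m n) :
    Nonempty (Iso
      (F.sum (ofPredicates k (S := ℕ ⊕ ℕ) (fun s => s.isLeft) fun s => s.isRight))
      (G.sum (ofPredicates k (S := ℕ ⊕ ℕ) (fun s => s.isLeft) fun s => s.isRight))) := by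
  classical
  obtain ⟨S, hS, p₁, p₂, ⟨e⟩, h₁, h₂, hm, hn⟩ := hF
  obtain ⟨S', hS', p₁', p₂', ⟨e'⟩, h₁', h₂', rfl, rfl⟩ := hG
  refine iso_equivalence.trans ⟨e.sumCongr (iso_equivalence.refl _).some⟩
    (iso_equivalence.trans ?_ (iso_equivalence.symm ⟨e'.sumCongr (iso_equivalence.refl _).some⟩))
  refine iso_equivalence.trans ⟨Iso.sumOfPredicates _ _ _ _⟩
    (iso_equivalence.trans ?_ (iso_equivalence.symm ⟨Iso.sumOfPredicates _ _ _ _⟩))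
  -- An isomorphism is a bijection of index sets preserving the pair of truth values, so it suffices
  -- to match the four fibres of `t`.
  let t {S : Type} (p₁ p₂ : S → Prop) (x : S ⊕ (ℕ ⊕ ℕ)) : Prop × Prop :=
    (Sum.elim p₁ (fun s => s.isLeft = true) x, Sum.elim p₂ (fun s => s.isRight = true) x)
  have fib {S : Type} (p₁ p₂ : S → Prop) (c : Prop × Prop) : {x // t p₁ p₂ x = c} ≃
      {s // (p₁ s ↔ c.1) ∧ (p₂ s ↔ c.2)} ⊕
        {s : ℕ ⊕ ℕ // (s.isLeft = true ↔ c.1) ∧ (s.isRight = true ↔ c.2)} :=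
    Equiv.subtypeSum.trans (Equiv.sumCongr
      (Equiv.subtypeEquivRight fun s => by simp [t, Prod.ext_iff])
      (Equiv.subtypeEquivRight fun s => by simp [t, Prod.ext_iff]))
  have key (c : Prop × Prop) : Nonempty ({x // t p₁ p₂ x = c} ≃ {x // t p₁' p₂' x = c}) := by
    by_cases hc : c.1 ↔ c.2
    · have : Nonempty ({s // (p₁ s ↔ c.1) ∧ (p₂ s ↔ c.2)} ≃
          {s // (p₁' s ↔ c.1) ∧ (p₂' s ↔ c.2)}) := by
        by_cases h : c.2
        · simp only [hc, h, iff_true]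
          exact Finite.card_eq.1 hm
        · simp only [hc, h, iff_false]
          exact Finite.card_eq.1 hn
      obtain ⟨g⟩ := this
      exact ⟨(fib p₁ p₂ c).trans ((Equiv.sumCongr g (Equiv.refl _)).trans (fib p₁' p₂' c).symm)⟩
    -- Over a mixed value the acyclic summand makes both fibres countably infinite, whatever `S` and
    -- `S'` contribute.
    · have : Infinite {s : ℕ ⊕ ℕ // (s.isLeft = true ↔ c.1) ∧ (s.isRight = true ↔ c.2)} := by
        by_cases h : c.1
        · have h' : ¬ c.2 := fun h' => hc (iff_of_true h h')
          exact Infinite.of_injective (fun n : ℕ => ⟨.inl n, by simp [h, h']⟩)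
            fun a b hab => by simpa using hab
        · have h' : c.2 := by_contra fun h' => hc (iff_of_false h h')
          exact Infinite.of_injective (fun n : ℕ => ⟨.inr n, by simp [h, h']⟩)
            fun a b hab => by simpa using hab
      have i₁ := Infinite.of_injective _ ((fib p₁ p₂ c).symm.injective.comp Sum.inr_injective)
      have i₂ := Infinite.of_injective _ ((fib p₁' p₂' c).symm.injective.comp Sum.inr_injective)
      exact nonempty_equiv_of_countable
  let g := fun c => (key c).some
  have hg (x) : t p₁' p₂' (Equiv.ofFiberEquiv g x) = t p₁ p₂ x := Equiv.ofFiberEquiv_map g x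
  exact ⟨Iso.ofPredicatesCongr (Equiv.ofFiberEquiv g)
    (fun x => iff_of_eq (congrArg Prod.fst (hg x)).symm)
    (fun x => iff_of_eq (congrArg Prod.snd (hg x)).symm)⟩

end KDiagram

/-! ### Numerical invariants that determine virtual objects. -/

section Classes

variable {k : Type u} [Field k]

/-- Classes of virtual diagrams are determined by the numbers of summands of the two kinds. -/
lemma Virtual.mk_eq_mk_of_hasType {F₁ F₂ G₁ G₂ : FredholmDiagram k} {a₁ b₁ a₂ b₂ c₁ d₁ c₂ d₂ : ℕ}
    (hF₁ : F₁.1.HasType a₁ b₁) (hF₂ : F₂.1.HasType a₂ b₂) (hG₁ : G₁.1.HasType c₁ d₁)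
    (hG₂ : G₂.1.HasType c₂ d₂) (h : a₁ + c₂ = c₁ + a₂) (h' : b₁ + d₂ = d₁ + b₂) :
    Virtual.mk F₁ F₂ = Virtual.mk G₁ G₂ := by
  refine Quotient.sound ⟨⟨_, KDiagram.hasType_acyclic.isFredholm⟩, ?_⟩
  have := hF₁.sum hG₂
  rw [h, h'] at this
  exact this.nonempty_iso_sum (hG₁.sum hF₂)

/-- Classes of virtual vector spaces are determined by their dimensions. -/
lemma Virtual.mk_eq_mk_of_finrank {V₁ V₂ W₁ W₂ : FGModuleCat.{u} k}
    (h : Module.finrank k V₁ + Module.finrank k W₂ = Module.finrank k W₁ + Module.finrank k V₂) :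
    Virtual.mk V₁ V₂ = Virtual.mk W₁ W₂ := by
  -- Dimensions already agree without stabilizing, so any auxiliary summand serves; `k` is an
  -- arbitrary choice.
  refine Quotient.sound ⟨FGModuleCat.of k k, ⟨LinearEquiv.ofFinrankEq _ _ ?_⟩⟩
  change Module.finrank k ((V₁ × W₂) × k) = Module.finrank k ((W₁ × V₂) × k)
  rw [Module.finrank_prod, Module.finrank_prod, Module.finrank_prod, Module.finrank_prod, h]

end Classes

/-! ### Quadrant sums of weights, computed on large boxes. -/

/-- The sum of `W` over the box of side `N` with largest corner `d`. -/
noncomputable def lowerSum (W : (Fin 2 → ℤ) → ℤ) (d : Fin 2 → ℤ) (N : ℕ) : ℤ :=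
  ∑ a ∈ Finset.Icc (d - fun _ => (N : ℤ)) d, W a

/-- The sum of `W` over the box of side `N` with smallest corner `d + 1`. -/
noncomputable def upperSum (W : (Fin 2 → ℤ) → ℤ) (d : Fin 2 → ℤ) (N : ℕ) : ℤ :=
  ∑ a ∈ Finset.Icc (d + 1) (d + 1 + fun _ => (N : ℤ)), W a

section Boxes

lemma mem_Icc_fin_two {l u a : Fin 2 → ℤ} :
    a ∈ Finset.Icc l u ↔ (l 0 ≤ a 0 ∧ l 1 ≤ a 1) ∧ a 0 ≤ u 0 ∧ a 1 ≤ u 1 := by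
  simp [Finset.mem_Icc, Pi.le_def, Fin.forall_fin_two]

lemma sum_Icc_fin_two (W : (Fin 2 → ℤ) → ℤ) (l u : Fin 2 → ℤ) :
    ∑ a ∈ Finset.Icc l u, W a =
      ∑ x ∈ Finset.Icc (l 0) (u 0), ∑ y ∈ Finset.Icc (l 1) (u 1), W ![x, y] := by
  rw [← Finset.sum_product']
  refine Finset.sum_nbij' (fun a => (a 0, a 1)) (fun x => ![x.1, x.2]) ?_ ?_ ?_ ?_ ?_
  · intro a ha
    rw [mem_Icc_fin_two] at ha
    simp [ha]
  · intro x hx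
    simp only [Finset.mem_product, Finset.mem_Icc] at hx
    rw [mem_Icc_fin_two]
    exact ⟨⟨hx.1.1, hx.2.1⟩, hx.1.2, hx.2.2⟩
  · intro a _
    ext i
    fin_cases i <;> rfl
  · intro x _
    rfl
  · intro a _
    congr 1
    ext i
    fin_cases i <;> rfl

lemma sum_Icc_int_sub (φ : ℤ → ℤ) {l u : ℤ} (h : l ≤ u) :
    ∑ x ∈ Finset.Icc l u, (φ x - φ (x - 1)) = φ u - φ (l - 1) := by
  induction u, h using Int.leInduction with
  | base => simp
  | succ u hu ih =>
    have : Finset.Icc l (u + 1) = insert (u + 1) (Finset.Icc l u) := by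
      ext
      simp only [Finset.mem_Icc, Finset.mem_insert]
      omega
    rw [this, Finset.sum_insert (by simp), ih, add_sub_cancel_right]
    ring

/-- The weight is a mixed second difference, so the sum telescopes in each variable and leaves the
four corners. -/
lemma sum_Icc_weight (g : (Fin 2 → ℤ) → ℤ) {l u : Fin 2 → ℤ} (h : l ≤ u) :
    ∑ a ∈ Finset.Icc l u, weight g a =
      g u - g ![l 0 - 1, u 1] - g ![u 0, l 1 - 1] + g ![l 0 - 1, l 1 - 1] := by
  have hw (x y : ℤ) : weight g ![x, y] =
      (g ![x, y] - g ![x - 1, y]) - (g ![x, y - 1] - g ![x - 1, y - 1]) := by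
    have h₁ : ![x, y] - Pi.single 0 1 = ![x - 1, y] := by ext i; fin_cases i <;> simp
    have h₂ : ![x, y] - Pi.single 1 1 = ![x, y - 1] := by ext i; fin_cases i <;> simp
    have h₃ : ![x, y] - (Pi.single 0 1 + Pi.single 1 1) = ![x - 1, y - 1] := by
      ext i; fin_cases i <;> simp
    rw [weight_two, h₁, h₂, h₃]
    ring
  have hu : g u = g ![u 0, u 1] := by
    congr 1
    ext i
    fin_cases i <;> rfl
  rw [sum_Icc_fin_two, Finset.sum_congr rfl fun x _ => (Finset.sum_congr rfl fun y _ => hw x y).trans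
    (sum_Icc_int_sub (fun y => g ![x, y] - g ![x - 1, y]) (h 1)), Finset.sum_sub_distrib,
    sum_Icc_int_sub (fun x => g ![x, u 1]) (h 0), sum_Icc_int_sub (fun x => g ![x, l 1 - 1]) (h 0),
    hu]
  ring

lemma deg_fin_two (a : Fin 2 → ℤ) : deg a = a 0 + a 1 := by
  rw [deg, Fin.sum_univ_two]

open Filter

/-- A point `a ≤ d` of degree above `m` has each coordinate within `deg d - m` of that of `d`, so
one box holds the whole support in the quadrant. -/
lemma InitiallyZero.eventually_mem_Icc {W : (Fin 2 → ℤ) → ℤ} (h : InitiallyZero W)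
    (d : Fin 2 → ℤ) : ∀ᶠ N : ℕ in atTop, ∀ a, a 0 ≤ d 0 ∧ a 1 ≤ d 1 → W a ≠ 0 →
      a ∈ Finset.Icc (d - fun _ => (N : ℤ)) d := by
  obtain ⟨m, hm⟩ := h
  filter_upwards [eventually_ge_atTop (deg d - m).toNat] with N hN a ha hW
  have := not_imp_not.2 (hm a) hW
  rw [deg_fin_two] at this hN
  rw [mem_Icc_fin_two]
  simp only [Pi.sub_apply]
  omega

lemma EventuallyZero.eventually_mem_Icc {W : (Fin 2 → ℤ) → ℤ} (h : EventuallyZero W)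
    (d : Fin 2 → ℤ) : ∀ᶠ N : ℕ in atTop, ∀ a, ¬ a 0 ≤ d 0 ∧ ¬ a 1 ≤ d 1 → W a ≠ 0 →
      a ∈ Finset.Icc (d + 1) (d + 1 + fun _ => (N : ℤ)) := by
  obtain ⟨m, hm⟩ := h
  filter_upwards [eventually_ge_atTop (m - deg d).toNat] with N hN a ha hW
  have := not_imp_not.2 (hm a) hW
  rw [deg_fin_two] at this hN
  rw [mem_Icc_fin_two]
  simp only [Pi.add_apply, Pi.one_apply]
  omega

variable {g : (Fin 2 → ℤ) → ℤ} {C : ℤ}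

/-- For a large box only the corner `d` survives: the other three have small degree, where `g`
vanishes. -/
lemma IsRiemannFunction.eventually_lowerSum (hg : IsRiemannFunction g C) (d : Fin 2 → ℤ) :
    ∀ᶠ N : ℕ in atTop, lowerSum (weight g) d N = g d := by
  obtain ⟨⟨m, hm⟩, -⟩ := hg
  filter_upwards [eventually_ge_atTop (deg d - m).toNat] with N hN
  rw [deg_fin_two] at hN
  rw [lowerSum, sum_Icc_weight, hm ![_, d 1], hm ![d 0, _], hm ![_ - 1, _ - 1]]
  · ring
  any_goals
    simp [deg_fin_two]
    omega
  · simp [Pi.le_def]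

/-- The lowest corner is `d`. The other three have large degree, where `g = deg + C`, and together
contribute `-deg d - C`. -/
lemma IsRiemannFunction.eventually_upperSum (hg : IsRiemannFunction g C) (d : Fin 2 → ℤ) :
    ∀ᶠ N : ℕ in atTop, upperSum (weight g) d N = g d - deg d - C := by
  obtain ⟨-, m, hm⟩ := hg
  have hd : ![(d + 1) 0 - 1, (d + 1) 1 - 1] = d := by
    ext i
    fin_cases i <;> simp
  filter_upwards [eventually_ge_atTop (m - deg d).toNat] with N hN
  rw [deg_fin_two] at hN
  rw [upperSum, sum_Icc_weight, hd, hm (d + 1 + _), hm ![(d + 1) 0 - 1, _], hm ![_, (d + 1) 1 - 1]]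
  · simp [deg_fin_two]
    ring
  any_goals
    simp [deg_fin_two]
    omega
  · simp [Pi.le_def]

/-- The reflection `a ↦ d + e + 1 - a` exchanges the boxes ending at `e` and starting at `d + 1`.
With `upperSum_dualWeight`, this is the combinatorial source of the duality. -/
lemma lowerSum_dualWeight (W : (Fin 2 → ℤ) → ℤ) (d e : Fin 2 → ℤ) (N : ℕ) :
    lowerSum (dualWeight W (d + e + 1)) e N = upperSum W d N := by
  refine Finset.sum_nbij' (fun a => d + e + 1 - a) (fun a => d + e + 1 - a) ?_ ?_ ?_ ?_ ?_
  · intro a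
    simp only [mem_Icc_fin_two, Pi.add_apply, Pi.sub_apply, Pi.one_apply]
    omega
  · intro a
    simp only [mem_Icc_fin_two, Pi.add_apply, Pi.sub_apply, Pi.one_apply]
    omega
  all_goals simp [dualWeight]

lemma upperSum_dualWeight (W : (Fin 2 → ℤ) → ℤ) (d e : Fin 2 → ℤ) (N : ℕ) :
    upperSum (dualWeight W (d + e + 1)) e N = lowerSum W d N := by
  refine Finset.sum_nbij' (fun a => d + e + 1 - a) (fun a => d + e + 1 - a) ?_ ?_ ?_ ?_ ?_
  · intro a
    simp only [mem_Icc_fin_two, Pi.add_apply, Pi.sub_apply, Pi.one_apply]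
    omega
  · intro a
    simp only [mem_Icc_fin_two, Pi.add_apply, Pi.sub_apply, Pi.one_apply]
    omega
  all_goals simp [dualWeight]

/-- The elements of the multiset `W` in a region correspond to the points of a box, with
multiplicities. -/
def multiEquiv (W : (Fin 2 → ℤ) → ℤ) (q : (Fin 2 → ℤ) → Prop) (B : Finset (Fin 2 → ℤ))
    (hB : ∀ a ∈ B, q a) (hW : ∀ a, q a → W a ≠ 0 → a ∈ B) :
    {s : Multi W // q s.1.1} ≃ Σ a : B, Fin (W a).toNat where
  toFun s := ⟨⟨s.1.1.1, hW _ s.2 (by have := s.1.2; omega)⟩,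
    -- Multiplicity labels start at 1 in `Multi` and at 0 in `Fin`.
    ⟨s.1.1.2 - 1, by have := s.1.2; simp only; omega⟩⟩
  invFun x := ⟨⟨(x.1.1, x.2 + 1), by have := x.2.2; simp only; omega⟩, hB _ x.1.2⟩
  left_inv s := by
    refine Subtype.ext (Subtype.ext (Prod.ext rfl ?_))
    have := s.1.2
    simp only
    omega
  right_inv x := rfl

end Boxes

/-! ### Counting the summands of the models. -/

section Types

open Filter KDiagram

variable (k : Type u) [Field k]

/-- The summands are indexed by `Multi W`; counting those in a quadrant with multiplicity gives the
sum of `W` there because `W ≥ 0`. The statement for all large `N` lets several weights be compared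
on a common box. -/
lemma indicatorSum_hasType {W : (Fin 2 → ℤ) → ℤ} (hW : ∀ a, 0 ≤ W a) (h : InitiallyZero W)
    (h' : EventuallyZero W) (d : Fin 2 → ℤ) :
    ∃ m n : ℕ, (indicatorSum k W d).HasType m n ∧
      ∀ᶠ N : ℕ in atTop, lowerSum W d N = m ∧ upperSum W d N = n := by
  have hlow := h.eventually_mem_Icc d
  have hupp := h'.eventually_mem_Icc d
  let e₁ (N : ℕ) := multiEquiv W (fun a => a 0 ≤ d 0 ∧ a 1 ≤ d 1)
    (Finset.Icc (d - fun _ => (N : ℤ)) d) (fun a ha => (mem_Icc_fin_two.1 ha).2)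
  let e₂ (N : ℕ) := multiEquiv W (fun a => ¬ a 0 ≤ d 0 ∧ ¬ a 1 ≤ d 1)
    (Finset.Icc (d + 1) (d + 1 + fun _ => (N : ℤ))) (fun a ha => by
      have := (mem_Icc_fin_two.1 ha).1
      simp only [Pi.add_apply, Pi.one_apply] at this
      omega)
  obtain ⟨N₁, h₁⟩ := hlow.exists
  obtain ⟨N₂, h₂⟩ := hupp.exists
  refine ⟨_, _, ⟨Multi W, inferInstance, fun s => s.1.1 0 ≤ d 0, fun s => s.1.1 1 ≤ d 1, ?_,
    .of_equiv _ (e₁ N₁ h₁).symm, .of_equiv _ (e₂ N₂ h₂).symm, rfl, rfl⟩, ?_⟩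
  · exact iso_equivalence.trans
      ⟨Iso.directSumCongr fun s => (nonempty_iso_indicatorDiagram s.1.1 d).some⟩
      (iso_equivalence.trans ⟨Iso.directSumOfPredicates _ _⟩
        ⟨Iso.ofPredicatesCongr (Equiv.sigmaPUnit _) (fun _ => Iff.rfl) fun _ => Iff.rfl⟩)
  · filter_upwards [hlow, hupp] with N h₁ h₂
    rw [Nat.card_congr (e₁ N h₁), Nat.card_congr (e₂ N h₂), Nat.card_sigma, Nat.card_sigma]
    simp only [Nat.card_fin, Nat.cast_sum, Int.toNat_of_nonneg (hW _)]
    exact ⟨(Finset.sum_coe_sort _ _).symm, (Finset.sum_coe_sort _ _).symm⟩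

lemma IsPerfectMatching.nonneg {W : (Fin 2 → ℤ) → ℤ} (h : IsPerfectMatching W) (a : Fin 2 → ℤ) :
    0 ≤ W a := by
  obtain ⟨-, -, π, hπ⟩ := h
  rw [hπ]
  split_ifs <;> simp

/-- The multiset of a perfect matching is parametrized by the first coordinate. -/
lemma IsPerfectMatching.exists_equiv {W : (Fin 2 → ℤ) → ℤ} (h : IsPerfectMatching W) :
    ∃ e₁ e₂ : Multi W ≃ ℤ, (∀ s, e₁ s = s.1.1 0) ∧ ∀ s, e₂ s = s.1.1 1 := by
  obtain ⟨-, -, π, hπ⟩ := h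
  have hs (s : Multi W) : s.1.1 1 = π (s.1.1 0) ∧ s.1.2 = 1 := by
    have h₁ := s.2
    rw [hπ] at h₁
    split_ifs at h₁ with h₂
    · exact ⟨h₂, by omega⟩
    · omega
  let e : Multi W ≃ ℤ :=
    { toFun := fun s => s.1.1 0
      invFun := fun x => ⟨(![x, π x], 1), by simp [hπ]⟩
      left_inv := fun s => by
        refine Subtype.ext (Prod.ext (funext fun i => ?_) (hs s).2.symm)
        fin_cases i
        · rfl
        · exact (hs s).1.symm
      right_inv := fun x => rfl }
  exact ⟨e, e.trans π, fun s => rfl, fun s => (hs s).1.symm⟩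

variable {k} in
-- Both coordinate projections of the matching are bijections onto `ℤ`, so the bases of `A₁` and
-- `A₂` can be relabelled by matched pairs, which turns `ρ₃₁` and `ρ₃₂` into identities.
lemma IsPerfectMatching.nonempty_iso {W : (Fin 2 → ℤ) → ℤ} (h : IsPerfectMatching W)
    (d : Fin 2 → ℤ) : Nonempty (Iso (matchingDiagram k W d)
      (ofPredicates k (fun s : Multi W => s.1.1 0 ≤ d 0) fun s => s.1.1 1 ≤ d 1)) := by
  obtain ⟨e₁, e₂, h₁, h₂⟩ := h.exists_equiv
  refine ⟨Iso.ofBases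
    (Finsupp.basisSingleOne.reindex (e₁.subtypeEquiv fun s => by rw [h₁]).symm)
    (Finsupp.basisSingleOne.reindex (e₂.subtypeEquiv fun s => by rw [h₂]).symm)
    Finsupp.basisSingleOne (Finsupp.basisSingleOne.reindex e₁.symm)
    (Finsupp.basisSingleOne.reindex e₂.symm) ?_ ?_ ?_ ?_⟩
  · exact fun s => by simp
  · exact fun s => by simp
  · exact fun s => by simp [h₁]
  · exact fun s => by simp [h₂]

lemma matchingSum_hasType {S : Type} [Finite S] {P : S → (Fin 2 → ℤ) → ℤ}
    (hP : ∀ l, IsPerfectMatching (P l)) (d : Fin 2 → ℤ) :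
    ∃ m n : ℕ, (matchingSum k P d).HasType m n ∧
      ∀ᶠ N : ℕ in atTop, lowerSum (fun a => ∑ᶠ l, P l a) d N = m ∧
        upperSum (fun a => ∑ᶠ l, P l a) d N = n := by
  have := Fintype.ofFinite S
  have hlow := eventually_all.2 fun l => (hP l).1.eventually_mem_Icc d
  have hupp := eventually_all.2 fun l => (hP l).2.1.eventually_mem_Icc d
  let f₁ (q : (Fin 2 → ℤ) → Prop) : {s : Σ l, Multi (P l) // q s.2.1.1} ≃
      Σ l, {s : Multi (P l) // q s.1.1} :=
    ⟨fun s => ⟨s.1.1, s.1.2, s.2⟩, fun s => ⟨⟨s.1, s.2.1⟩, s.2.2⟩, fun _ => rfl, fun _ => rfl⟩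
  let e₁ (N : ℕ) (h : ∀ l a, a 0 ≤ d 0 ∧ a 1 ≤ d 1 → P l a ≠ 0 →
      a ∈ Finset.Icc (d - fun _ => (N : ℤ)) d) :=
    (f₁ fun a => a 0 ≤ d 0 ∧ a 1 ≤ d 1).trans (Equiv.sigmaCongrRight fun l =>
      multiEquiv (P l) (fun a => a 0 ≤ d 0 ∧ a 1 ≤ d 1) (Finset.Icc (d - fun _ => (N : ℤ)) d)
        (fun a ha => (mem_Icc_fin_two.1 ha).2) (h l))
  let e₂ (N : ℕ) (h : ∀ l a, ¬ a 0 ≤ d 0 ∧ ¬ a 1 ≤ d 1 → P l a ≠ 0 →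
      a ∈ Finset.Icc (d + 1) (d + 1 + fun _ => (N : ℤ))) :=
    (f₁ fun a => ¬ a 0 ≤ d 0 ∧ ¬ a 1 ≤ d 1).trans (Equiv.sigmaCongrRight fun l =>
      multiEquiv (P l) (fun a => ¬ a 0 ≤ d 0 ∧ ¬ a 1 ≤ d 1)
        (Finset.Icc (d + 1) (d + 1 + fun _ => (N : ℤ))) (fun a ha => by
          have := (mem_Icc_fin_two.1 ha).1
          simp only [Pi.add_apply, Pi.one_apply] at this
          omega) (h l))
  obtain ⟨N₁, h₁⟩ := hlow.exists
  obtain ⟨N₂, h₂⟩ := hupp.exists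
  refine ⟨_, _, ⟨Σ l, Multi (P l), inferInstance, fun s => s.2.1.1 0 ≤ d 0,
    fun s => s.2.1.1 1 ≤ d 1, ?_, .of_equiv _ (e₁ N₁ h₁).symm, .of_equiv _ (e₂ N₂ h₂).symm,
    rfl, rfl⟩, ?_⟩
  · exact iso_equivalence.trans ⟨Iso.directSumCongr fun l => ((hP l).nonempty_iso d).some⟩
      ⟨Iso.directSumOfPredicates _ _⟩
  · filter_upwards [hlow, hupp] with N h₁ h₂
    rw [Nat.card_congr (e₁ N h₁), Nat.card_congr (e₂ N h₂), Nat.card_sigma, Nat.card_sigma]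
    simp only [Nat.card_sigma, Nat.card_fin, Nat.cast_sum, Int.toNat_of_nonneg ((hP _).nonneg _)]
    simp only [lowerSum, upperSum, finsum_eq_sum_of_fintype]
    rw [Finset.sum_comm, Finset.sum_comm (s := Finset.Icc (d + 1) _)]
    exact ⟨Finset.sum_congr rfl fun l _ => (Finset.sum_coe_sort _ _).symm,
      Finset.sum_congr rfl fun l _ => (Finset.sum_coe_sort _ _).symm⟩

end Types

/-! ### Bounded weights as differences of sums of perfect matchings. -/

section Decomposition

open Finset in
lemma weight_add {n : ℕ} (f g : (Fin n → ℤ) → ℤ) : weight (f + g) = weight f + weight g := by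
  ext d
  simp [weight, mul_add, sum_add_distrib]

/-- Taking weights, as an additive map. -/
def weightHom : ((Fin 2 → ℤ) → ℤ) →+ ((Fin 2 → ℤ) → ℤ) :=
  AddMonoidHom.mk' weight weight_add

/-- The differences of sums of equally many perfect matchings. -/
def matchingDifferences : AddSubgroup ((Fin 2 → ℤ) → ℤ) where
  carrier := {W | ∃ P Q : Multiset ((Fin 2 → ℤ) → ℤ), (∀ p ∈ P, IsPerfectMatching p) ∧
    (∀ p ∈ Q, IsPerfectMatching p) ∧ P.card = Q.card ∧ W + Q.sum = P.sum}
  zero_mem' := ⟨0, 0, by simp, by simp, rfl, by simp⟩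
  add_mem' := by
    rintro W W' ⟨P, Q, hP, hQ, hc, h⟩ ⟨P', Q', hP', hQ', hc', h'⟩
    refine ⟨P + P', Q + Q', ?_, ?_, by simp [hc, hc'], ?_⟩
    · exact fun p hp => (Multiset.mem_add.1 hp).elim (hP p) (hP' p)
    · exact fun p hp => (Multiset.mem_add.1 hp).elim (hQ p) (hQ' p)
    · rw [Multiset.sum_add, Multiset.sum_add, ← h, ← h']
      abel
  neg_mem' := by
    rintro W ⟨P, Q, hP, hQ, hc, h⟩
    exact ⟨Q, P, hQ, hP, hc.symm, by rw [← h]; abel⟩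

/-- The indicator function of the antidiagonal of level `t`. -/
def antidiagonalIndicator (t : ℤ) : (Fin 2 → ℤ) → ℤ := fun a => if a 0 + a 1 = t then 1 else 0

lemma isPerfectMatching_of_perm (W : (Fin 2 → ℤ) → ℤ) (π : Equiv.Perm ℤ)
    (hW : ∀ a, W a = if a 1 = π (a 0) then 1 else 0) (l u : ℤ)
    (hπ : ∀ x, l < x + π x ∧ x + π x < u) : IsPerfectMatching W := by
  refine ⟨⟨l, fun a ha => ?_⟩, ⟨u, fun a ha => ?_⟩, π, hW⟩
  all_goals
    rw [hW, if_neg]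
    intro h
    have := hπ (a 0)
    rw [deg_fin_two] at ha
    omega

lemma antidiagonalIndicator_isPerfectMatching (t : ℤ) :
    IsPerfectMatching (antidiagonalIndicator t) := by
  refine isPerfectMatching_of_perm _ (Equiv.subLeft t) (fun a => ?_) (t - 1) (t + 1) fun x => ?_
  · simp only [antidiagonalIndicator, Equiv.subLeft_apply]
    congr 1
    exact propext (by omega)
  · simp only [Equiv.subLeft_apply]
    omega

/-- The permutation that exchanges `x` and `x + 1` for all `x` in a set without consecutive
elements. -/
def swapSucc (A : ℤ → Prop) [DecidablePred A] (hA : ∀ x, A x → ¬ A (x + 1)) : Equiv.Perm ℤ :=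
  Function.Involutive.toPerm (fun x => if A x then x + 1 else if A (x - 1) then x - 1 else x) (by
    intro x
    by_cases h : A x
    · simp [h, hA x h]
    · by_cases h' : A (x - 1)
      · simp [h, h']
      · simp [h, h'])

/-- The weight of the indicator function of a set without consecutive elements, placed on the
antidiagonal of level `s`, is a difference of two perfect matchings. -/
lemma weight_level_mem (s : ℤ) (A : ℤ → Prop) [DecidablePred A] (hA : ∀ x, A x → ¬ A (x + 1)) :
    weight (fun a => if A (a 0) ∧ a 0 + a 1 = s then 1 else 0) ∈ matchingDifferences := by
  let π : Equiv.Perm ℤ := (swapSucc A hA).trans (Equiv.subLeft (s + 1))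
  have hπ (x : ℤ) : π x = s + 1 - if A x then x + 1 else if A (x - 1) then x - 1 else x := rfl
  let W : (Fin 2 → ℤ) → ℤ := fun a => if a 1 = π (a 0) then 1 else 0
  have hW : IsPerfectMatching W := by
    -- The graph of `π` meets only the degrees `s`, `s + 1` and `s + 2`.
    refine isPerfectMatching_of_perm W π (fun a => rfl) (s - 1) (s + 3) fun x => ?_
    rw [hπ]
    split_ifs <;> omega
  -- Each `x` in `A` contributes `+1` at `(x, s - x)` and `(x + 1, s + 1 - x)`, and `-1` at `(x + 1,
  -- s - x)` and `(x, s + 1 - x)`. The last two lie on the antidiagonal of level `s + 1`; adding it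
  -- cancels them and leaves the graph of `π`. Distinct `x` do not interfere because `A` has no
  -- consecutive elements.
  refine ⟨{W}, {antidiagonalIndicator (s + 1)}, ?_, ?_, rfl, ?_⟩
  · simpa using hW
  · simpa using antidiagonalIndicator_isPerfectMatching (s + 1)
  · rw [Multiset.sum_singleton, Multiset.sum_singleton]
    ext a
    simp only [W, Pi.add_apply, weight_two, antidiagonalIndicator, hπ, Pi.sub_apply]
    by_cases h : A (a 0)
    · have h' : ¬ A (a 0 - 1) := fun h' => hA _ h' (by simpa using h)
      simp [h, h']
      split_ifs <;> omega
    · by_cases h' : A (a 0 - 1)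
      · simp [h, h']
        split_ifs <;> omega
      · simp [h, h']
        split_ifs <;> omega

lemma weight_indicator_mem (Z : (Fin 2 → ℤ) → Prop) [DecidablePred Z] (l u : ℤ)
    (hZ : ∀ a, Z a → l ≤ deg a ∧ deg a ≤ u) :
    weight (fun a => if Z a then 1 else 0) ∈ matchingDifferences := by
  -- Slice by the level `s` and by the parity `ε` of the first coordinate; fixing the parity rules
  -- out consecutive elements.
  let F (s ε : ℤ) : (Fin 2 → ℤ) → ℤ := fun a =>
    if (Z ![a 0, s - a 0] ∧ a 0 % 2 = ε) ∧ a 0 + a 1 = s then 1 else 0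
  have hF (s ε : ℤ) : F s ε ∈ matchingDifferences.comap weightHom :=
    show weight _ ∈ _ from weight_level_mem s (fun x => Z ![x, s - x] ∧ x % 2 = ε) fun x hx hx' => by
      have := hx.2
      have := hx'.2
      omega
  have hsum : (fun a => if Z a then 1 else 0) = ∑ s ∈ Finset.Icc l u, (F s 0 + F s 1) := by
    ext a
    have ha (s : ℤ) : (F s 0 + F s 1) a = if deg a = s then if Z a then 1 else 0 else 0 := by
      rw [deg_fin_two]
      by_cases hs : a 0 + a 1 = s
      · have : ![a 0, s - a 0] = a := by
          ext i
          fin_cases i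
          · rfl
          · simp [← hs]
        simp only [F, Pi.add_apply, this, hs]
        rcases Int.emod_two_eq_zero_or_one (a 0) with h | h <;> simp [h]
      · simp [F, hs]
    rw [Finset.sum_apply, Finset.sum_congr rfl fun s _ => ha s, Finset.sum_ite_eq]
    by_cases h : Z a
    · rw [if_pos (Finset.mem_Icc.2 (hZ a h))]
    · simp [h]
  rw [hsum]
  exact AddSubgroup.sum_mem (matchingDifferences.comap weightHom) fun s _ =>
    AddSubgroup.add_mem _ (hF s 0) (hF s 1)

/-- The weight of a bounded function supported in a band is a difference of sums of equally many
perfect matchings. -/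
lemma weight_bounded_mem (l u : ℤ) (B : ℕ) : ∀ h : (Fin 2 → ℤ) → ℤ,
    (∀ a, h a ≠ 0 → l ≤ deg a ∧ deg a ≤ u) → (∀ a, |h a| ≤ B) →
      weight h ∈ matchingDifferences := by
  classical
  induction B with
  | zero =>
    intro h _ hB
    have : h = 0 := funext fun a => abs_nonpos_iff.1 (hB a)
    rw [this]
    exact (matchingDifferences.comap weightHom).zero_mem
  | succ B ih =>
    intro h hs hB
    -- Peel off the sets where `h` attains its extreme values `B + 1` and `-(B + 1)`; this lowers
    -- the bound by one.
    let h₁ : (Fin 2 → ℤ) → ℤ := fun a => if (B : ℤ) + 1 ≤ h a then 1 else 0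
    let h₂ : (Fin 2 → ℤ) → ℤ := fun a => if h a ≤ -((B : ℤ) + 1) then 1 else 0
    have e : h = (h - h₁ + h₂) + h₁ - h₂ := by abel
    have m₁ : weight h₁ ∈ matchingDifferences :=
      weight_indicator_mem (fun a => (B : ℤ) + 1 ≤ h a) l u fun a ha => hs a (by omega)
    have m₂ : weight h₂ ∈ matchingDifferences :=
      weight_indicator_mem (fun a => h a ≤ -((B : ℤ) + 1)) l u fun a ha => hs a (by omega)
    have m₃ : weight (h - h₁ + h₂) ∈ matchingDifferences := by
      refine ih _ (fun a ha => hs a fun h0 => ha ?_) fun a => ?_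
      · have : ¬ (B : ℤ) + 1 ≤ 0 := by omega
        have : ¬ (0 : ℤ) ≤ -((B : ℤ) + 1) := by omega
        simp only [Pi.add_apply, Pi.sub_apply, h₁, h₂, h0]
        split_ifs
        rfl
      · have := hB a
        push_cast at this
        rw [abs_le] at this ⊢
        simp only [Pi.add_apply, Pi.sub_apply, h₁, h₂]
        split_ifs <;> omega
    rw [e]
    exact AddSubgroup.sub_mem (matchingDifferences.comap weightHom)
      (AddSubgroup.add_mem _ m₃ m₁) m₂

/-- The weight expresses `h a` through three values of `h` in lower degrees. Starting from the
region where `h` vanishes, each degree turns a bound `B` into `M + 3 * B`, and finitely many degrees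
reach the region where `h` vanishes again. -/
lemma bounded_of_weight_bounded {h : (Fin 2 → ℤ) → ℤ} (h₀ : InitiallyZero h)
    (h₁ : EventuallyZero h) {M : ℤ} (hM : ∀ a, |weight h a| ≤ M) : ∃ B : ℕ, ∀ a, |h a| ≤ B := by
  obtain ⟨l, hl⟩ := h₀
  obtain ⟨u, hu⟩ := h₁
  have key (n : ℕ) : ∃ B : ℤ, 0 ≤ B ∧ ∀ a, deg a ≤ l + n → |h a| ≤ B := by
    induction n with
    | zero => exact ⟨0, le_rfl, fun a ha => by rw [hl a (by simpa using ha), abs_zero]⟩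
    | succ n ih =>
      obtain ⟨B, hB0, hB⟩ := ih
      have hM0 := (abs_nonneg _).trans (hM 0)
      refine ⟨M + 3 * B, by linarith, fun a ha => ?_⟩
      push_cast at ha
      have b₁ := abs_le.1 (hB (a - Pi.single 0 1) (by rw [deg_sub, deg_single]; linarith))
      have b₂ := abs_le.1 (hB (a - Pi.single 1 1) (by rw [deg_sub, deg_single]; linarith))
      have b₃ := abs_le.1 (hB (a - (Pi.single 0 1 + Pi.single 1 1))
        (by rw [deg_sub, deg_add, deg_single, deg_single]; linarith))
      have b₄ := abs_le.1 (hM a)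
      rw [weight_two] at b₄
      rw [abs_le]
      constructor <;> linarith
  obtain ⟨B, hB0, hB⟩ := key (u - l).toNat
  refine ⟨B.toNat, fun a => ?_⟩
  rw [Int.toNat_of_nonneg hB0]
  by_cases ha : u ≤ deg a
  · rwa [hu a ha, abs_zero]
  · exact hB a (by omega)

lemma Multiset.exists_eq_sum_fin {α : Type*} [AddCommMonoid α] (s : Multiset α) {n : ℕ}
    (h : s.card = n) : ∃ v : Fin n → α, (∀ i, v i ∈ s) ∧ s.sum = ∑ i, v i := by
  induction s using Quotient.inductionOn with
  | _ l =>
    subst h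
    refine ⟨l.get, fun i => List.get_mem l i, ?_⟩
    change l.sum = ∑ i : Fin l.length, l.get i
    rw [← List.sum_ofFn, List.ofFn_get]

/-- A bounded weight of a Riemann function is a difference of sums of perfect matchings. -/
lemma IsRiemannFunction.nonempty_matchingDecomposition {g : (Fin 2 → ℤ) → ℤ} {C : ℤ}
    (hg : IsRiemannFunction g C) {M : ℤ} (hM : ∀ a, |weight g a| ≤ M) :
    Nonempty (MatchingDecomposition (weight g)) := by
  -- The simplest Riemann function of offset `C`: subtracting it makes `g` vanish in large degrees
  -- as well, and its weight is a single perfect matching.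
  let j : (Fin 2 → ℤ) → ℤ := fun a => max (deg a + C) 0
  have hj : weight j = antidiagonalIndicator (1 - C) := by
    ext a
    simp only [weight_two, j, deg_sub, deg_add, deg_single, deg_fin_two a, antidiagonalIndicator]
    split_ifs <;> omega
  have e : weight g = weight (g - j) + weight j := by rw [← weight_add, sub_add_cancel]
  have h₀ : InitiallyZero (g - j) := by
    obtain ⟨⟨l, hl⟩, -⟩ := hg
    refine ⟨min l (-C), fun a ha => ?_⟩
    simp only [Pi.sub_apply, j, hl a (by omega)]
    omega
  have h₁ : EventuallyZero (g - j) := by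
    obtain ⟨-, u, hu⟩ := hg
    refine ⟨max u (-C), fun a ha => ?_⟩
    simp only [Pi.sub_apply, j, hu a (by omega)]
    omega
  have hM' (a) : |weight (g - j) a| ≤ M + 1 := by
    have := abs_le.1 (hM a)
    rw [e, hj, Pi.add_apply, antidiagonalIndicator] at this
    rw [abs_le]
    split_ifs at this <;> constructor <;> linarith
  obtain ⟨B, hB⟩ := bounded_of_weight_bounded h₀ h₁ hM'
  obtain ⟨l, hl⟩ := h₀
  obtain ⟨u, hu⟩ := h₁
  obtain ⟨P, Q, hP, hQ, hc, h⟩ := weight_bounded_mem l u B (g - j)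
    (fun a ha => ⟨by_contra fun h => ha (hl a (by omega)),
      by_contra fun h => ha (hu a (by omega))⟩) hB
  -- The matching contributed by `j` accounts for the one extra positive term, since `P` and `Q`
  -- have equal size.
  obtain ⟨p, hp, hp'⟩ := (antidiagonalIndicator (1 - C) ::ₘ P).exists_eq_sum_fin
    (n := Q.card + 1) (by simp [hc])
  obtain ⟨q, hq, hq'⟩ := Q.exists_eq_sum_fin rfl
  refine ⟨⟨Q.card, p, q, fun i => ?_, fun i => hQ _ (hq i), fun a => ?_⟩⟩
  · rcases Multiset.mem_cons.1 (hp i) with h | h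
    · rw [h]
      exact antidiagonalIndicator_isPerfectMatching _
    · exact hP _ h
  · rw [← Finset.sum_apply, ← Finset.sum_apply, ← hp', ← hq', Multiset.sum_cons, ← h, e, hj]
    simp only [Pi.add_apply]
    ring

end Decomposition

/-! ### The explicit duality for sums of perfect matchings. -/

section Duality

open KDiagram Filter

variable {k : Type u} [Field k]

lemma IsPerfectMatching.dualWeight {W : (Fin 2 → ℤ) → ℤ} (h : IsPerfectMatching W)
    (L : Fin 2 → ℤ) : IsPerfectMatching (dualWeight W L) := by
  obtain ⟨h₀, h₁, π, hπ⟩ := h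
  refine ⟨h₁.dualWeight L, h₀.dualWeight L,
    ((Equiv.subLeft (L 0)).trans π).trans (Equiv.subLeft (L 1)), fun a => ?_⟩
  simp only [_root_.dualWeight, hπ, Equiv.trans_apply, Equiv.subLeft_apply, Pi.sub_apply]
  congr 1
  exact propext (by omega)

variable {S : Type} [DecidableEq S]

/-- The class in `H¹` of a basis vector of a summand of `A₁`. -/
noncomputable def classA₁ (k : Type u) [Field k] (P : S → (Fin 2 → ℤ) → ℤ) (d : Fin 2 → ℤ)
    (l : S) (x : ℤ) : (matchingSum k P d).H1 :=
  Submodule.Quotient.mk (DirectSum.lof k S (fun _ => ℤ →₀ k) l (Finsupp.single x 1), 0)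

/-- The class in `H¹` of a basis vector of a summand of `A₂`. -/
noncomputable def classA₂ (k : Type u) [Field k] (P : S → (Fin 2 → ℤ) → ℤ) (d : Fin 2 → ℤ)
    (l : S) (y : ℤ) : (matchingSum k P d).H1 :=
  Submodule.Quotient.mk (0, DirectSum.lof k S (fun _ => ℤ →₀ k) l (Finsupp.single y 1))

variable {P : S → (Fin 2 → ℤ) → ℤ} {d e : Fin 2 → ℤ}

lemma classA₁_eq_zero {l : S} {x : ℤ} (hx : x ≤ d 0) : classA₁ k P d l x = 0 := by
  refine (Submodule.Quotient.mk_eq_zero _).2 ⟨_, (diff_lof (fun l => matchingDiagram k (P l) d) l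
    (Finsupp.single ⟨x, hx⟩ 1, 0, 0)).trans ?_⟩
  simp [diff]

lemma classA₂_eq_zero {l : S} {y : ℤ} (hy : y ≤ d 1) : classA₂ k P d l y = 0 := by
  refine (Submodule.Quotient.mk_eq_zero _).2 ⟨_, (diff_lof (fun l => matchingDiagram k (P l) d) l
    (0, Finsupp.single ⟨y, hy⟩ 1, 0)).trans ?_⟩
  simp [diff]

/-- The sum is the image of minus the basis vector of `B₃` at the matched pair `a`. With the two
vanishing lemmas, these relations present `H¹`. -/
lemma classA₁_add_classA₂ {l : S} {a : Fin 2 → ℤ} (ha : 1 ≤ P l a) :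
    classA₁ k P d l (a 0) + classA₂ k P d l (a 1) = 0 := by
  refine (Submodule.Quotient.mk_add _).symm.trans ((Submodule.Quotient.mk_eq_zero _).2
    ⟨_, (diff_lof (fun l => matchingDiagram k (P l) d) l
      (0, 0, -Finsupp.single ⟨(a, 1), le_rfl, by simpa using ha⟩ 1)).trans ?_⟩)
  simp [diff, ← Finsupp.single_neg, -map_neg]

lemma dual_H1_ext {w : Module.Dual k (matchingSum k P d).H1}
    (h₁ : ∀ l x, w (classA₁ k P d l x) = 0) (h₂ : ∀ l y, w (classA₂ k P d l y) = 0) : w = 0 := by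
  refine Submodule.linearMap_qext _ (LinearMap.prod_ext ?_ ?_)
  · refine DirectSum.linearMap_ext _ fun l => Finsupp.lhom_ext' fun x => LinearMap.ext_ring ?_
    exact h₁ l x
  · refine DirectSum.linearMap_ext _ fun l => Finsupp.lhom_ext' fun x => LinearMap.ext_ring ?_
    exact h₂ l x

/-- The coefficient of a global section at a basis vector of a summand of `B₁`. -/
noncomputable def coefficientB₁ (k : Type u) [Field k] (P : S → (Fin 2 → ℤ) → ℤ) (d : Fin 2 → ℤ)
    (l : S) (m : {x : ℤ // x ≤ d 0}) : (matchingSum k P d).H0 →ₗ[k] k :=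
  Finsupp.lapply m ∘ₗ DirectSum.component k S (fun _ => {x : ℤ // x ≤ d 0} →₀ k) l ∘ₗ
    LinearMap.fst k _ _ ∘ₗ Submodule.subtype _

/-- The global section given by a matched pair that lies below `d`. -/
noncomputable def basicSection (k : Type u) [Field k] (P : S → (Fin 2 → ℤ) → ℤ) (d : Fin 2 → ℤ)
    (l : S) (a : Fin 2 → ℤ) (ha : 1 ≤ P l a) (h₀ : a 0 ≤ d 0) (h₁ : a 1 ≤ d 1) :
    (matchingSum k P d).H0 :=
  ⟨(DirectSum.lof k S (fun _ => {x : ℤ // x ≤ d 0} →₀ k) l (Finsupp.single ⟨a 0, h₀⟩ 1),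
    DirectSum.lof k S (fun _ => {x : ℤ // x ≤ d 1} →₀ k) l (Finsupp.single ⟨a 1, h₁⟩ 1),
    DirectSum.lof k S (fun l => Multi (P l) →₀ k) l
      (Finsupp.single ⟨(a, 1), le_rfl, by simpa using ha⟩ 1)), by
    refine (diff_lof (fun l => matchingDiagram k (P l) d) l (Finsupp.single ⟨a 0, h₀⟩ 1,
      Finsupp.single ⟨a 1, h₁⟩ 1,
      Finsupp.single ⟨(a, 1), le_rfl, by simpa using ha⟩ 1)).trans ?_
    simp [diff]⟩

lemma coefficientB₁_basicSection {l l' : S} {a : Fin 2 → ℤ} (ha : 1 ≤ P l a) (h₀ : a 0 ≤ d 0)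
    (h₁ : a 1 ≤ d 1) (m : {x : ℤ // x ≤ d 0}) :
    coefficientB₁ k P d l' m (basicSection k P d l a ha h₀ h₁) =
      if l = l' ∧ a 0 = m then 1 else 0 := by
  change ((DirectSum.lof k S (fun _ => {x : ℤ // x ≤ d 0} →₀ k) l
    (Finsupp.single ⟨a 0, h₀⟩ 1)) l' : {x : ℤ // x ≤ d 0} →₀ k) m = _
  by_cases h : l = l'
  · subst h
    rw [DirectSum.lof_apply, Finsupp.single_apply]
    simp [Subtype.ext_iff]
  · rw [DirectSum.lof_eq_of, DirectSum.of_eq_of_ne _ _ _ (Ne.symm h)]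
    simp [h]

/-- The canonical duality `H¹(⨁ M_{P l, d})^* ≃ H⁰(⨁ M_{Q l, e})` for dual families of perfect
matchings. -/
lemma exists_isCanonicalDuality [Finite S] (hP : ∀ l, IsPerfectMatching (P l))
    {Q : S → (Fin 2 → ℤ) → ℤ} (hQ : Q = fun l => dualWeight (P l) (d + e + 1)) :
    ∃ φ : Module.Dual k (matchingSum k P d).H1 ≃ₗ[k] (matchingSum k Q e).H0,
      IsCanonicalDuality φ := by
  have hQ' (l) : IsPerfectMatching (Q l) := hQ ▸ (hP l).dualWeight _
  choose π hπ using fun l => (hP l).2.2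
  -- The matched pairs with both coordinates above `d`, recorded by their first coordinate; there
  -- are finitely many because matchings are eventually zero.
  let I : Type := Σ l, {x : ℤ // d 0 < x ∧ d 1 < π l x}
  have hI : Finite I := by
    have (l : S) : Finite {x : ℤ // d 0 < x ∧ d 1 < π l x} := by
      obtain ⟨m, hm⟩ := (hP l).2.1
      refine ((Set.finite_Icc (d 0) (m - d 1)).subset fun x hx => ⟨hx.1.le, ?_⟩).to_subtype
      have h₁ : ¬ m ≤ deg ![x, π l x] := fun h => by simpa [hπ] using hm _ h
      rw [deg_fin_two] at h₁
      simp at h₁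
      have := hx.2
      omega
    infer_instance
  have := Fintype.ofFinite I
  -- Reflection sends a pair above `d` matched by `P` to a pair below `e` matched by `Q`, which
  -- gives a global section.
  let s (i : I) : (matchingSum k Q e).H0 :=
    basicSection k Q e i.1 (d + e + 1 - ![i.2.1, π i.1 i.2.1]) (by simp [hQ, dualWeight, hπ])
      (by have := i.2.2; simp; omega) (by have := i.2.2; simp; omega)
  let φ : Module.Dual k (matchingSum k P d).H1 →ₗ[k] (matchingSum k Q e).H0 :=
    ∑ i : I, (Module.Dual.eval k _ (classA₁ k P d i.1 i.2.1)).smulRight (s i)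
  have hrel (l x) : classA₁ k P d l x + classA₂ k P d l (π l x) = 0 :=
    classA₁_add_classA₂ (a := ![x, π l x]) (by simp [hπ])
  have hφ (w l) (m : {x : ℤ // x ≤ e 0}) :
      coefficientB₁ k Q e l m (φ w) = w (classA₁ k P d l (d 0 + e 0 + 1 - m)) := by
    have hs (i) : coefficientB₁ k Q e l m (s i) =
        if i.1 = l ∧ d 0 + e 0 + 1 - i.2.1 = m then 1 else 0 := coefficientB₁_basicSection _ _ _ _
    have hsum : coefficientB₁ k Q e l m (φ w) = ∑ i : I, w (classA₁ k P d i.1 i.2.1) *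
        if i.1 = l ∧ d 0 + e 0 + 1 - i.2.1 = m then 1 else 0 := by
      simp only [φ, LinearMap.sum_apply, map_sum, LinearMap.smulRight_apply, map_smul, smul_eq_mul,
        Module.Dual.eval_apply, hs]
    rw [hsum]
    -- Put `x = d 0 + e 0 + 1 - m`, which exceeds `d 0`. If its partner exceeds `d 1`, exactly one
    -- term of the sum survives; otherwise the class of `x` in `A₁` is minus a class in `A₂` that
    -- vanishes, and no term survives.
    by_cases h : d 1 < π l (d 0 + e 0 + 1 - m)
    · rw [Finset.sum_eq_single (⟨l, d 0 + e 0 + 1 - m, by have := m.2; omega, h⟩ : I)]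
      · simp
      · rintro ⟨l', x, hx⟩ - hne
        rw [if_neg, mul_zero]
        rintro ⟨rfl, h'⟩
        refine hne ?_
        simp only at h'
        congr
        omega
      · simp
    · have h0 := hrel l (d 0 + e 0 + 1 - m)
      rw [classA₂_eq_zero (not_lt.1 h), add_zero] at h0
      rw [h0, map_zero]
      refine Finset.sum_eq_zero fun i _ => ?_
      rw [if_neg, mul_zero]
      rintro ⟨h₁, h₂⟩
      refine h ?_
      rw [← h₂, ← h₁, sub_sub_cancel]
      exact i.2.2.2
  have hinj : Function.Injective φ := by
    refine (injective_iff_map_eq_zero φ).2 fun w hw => ?_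
    -- The coefficient formula recovers `w` on the classes from `A₁` above `d 0`, the others being
    -- zero. Classes from `A₂` are minus those of their partners.
    have h₁ (l x) : w (classA₁ k P d l x) = 0 := by
      by_cases hx : x ≤ d 0
      · rw [classA₁_eq_zero hx, map_zero]
      · have := hφ w l ⟨d 0 + e 0 + 1 - x, by omega⟩
        rwa [hw, map_zero, sub_sub_cancel, eq_comm] at this
    refine dual_H1_ext h₁ fun l y => ?_
    have := congrArg w (hrel l ((π l).symm y))
    rwa [Equiv.apply_symm_apply, map_add, h₁, zero_add, map_zero] at this
  obtain ⟨m, n, hF, hn⟩ := matchingSum_hasType k hP d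
  obtain ⟨m', n', hG, hm'⟩ := matchingSum_hasType k hQ' e
  have := hF.isFredholm.finite_H1
  have := hG.isFredholm.finite_H0
  -- `n` counts pairs above `d` and `m'` counts reflected pairs below `e`; the counts are compared
  -- on a common large box.
  have hmn : m' = n := by
    obtain ⟨N, h, h'⟩ := (hn.and hm').exists
    have := lowerSum_dualWeight (fun a => ∑ᶠ l, P l a) d e N
    rw [h.2] at this
    have e' : (fun a => ∑ᶠ l, Q l a) = dualWeight (fun a => ∑ᶠ l, P l a) (d + e + 1) := by
      rw [hQ]
      rfl
    rw [← e', h'.1] at this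
    exact_mod_cast this
  refine ⟨φ.linearEquivOfInjective hinj ?_, hφ⟩
  rw [Subspace.dual_finrank_eq, hF.finrank_H1, hG.finrank_H0, hmn]

/-- The canonical dualities in both degrees, for dual families of perfect matchings. -/
lemma haveCanonicalDualities [Finite S] (hP : ∀ l, IsPerfectMatching (P l)) {L : Fin 2 → ℤ}
    (hL : L = d + e + 1) :
    HaveCanonicalDualities k P (fun l => dualWeight (P l) L) d e := by
  subst hL
  obtain ⟨φ, hφ⟩ := exists_isCanonicalDuality (k := k) (e := e) (d := d) hP rfl
  obtain ⟨φ', hφ'⟩ := exists_isCanonicalDuality (k := k) (d := e) (e := d)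
    (P := fun l => dualWeight (P l) (d + e + 1)) (Q := P) (fun l => (hP l).dualWeight _) (by
      ext l a
      simp [dualWeight, add_comm e d])
  obtain ⟨m, n, hG, -⟩ := matchingSum_hasType k (fun l => (hP l).dualWeight (d + e + 1)) e
  have := hG.isFredholm.finite_H1
  -- The degree-zero map is the transpose of `φ'`, with the finite dimensional `H¹` identified with
  -- its double dual.
  exact ⟨φ, φ', φ'.dualMap.trans (Module.evalEquiv k _).symm, hφ, hφ', fun u w =>
    Module.apply_evalEquiv_symm_apply _ _ w _⟩

end Duality

/-! ### Signed counts of virtual diagrams. -/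

section VirtualTypes

open Filter

variable {k : Type u} [Field k]

/-- The class `c` is a formal difference of countable sums of indicator diagrams, with `p` constant
summands and `q` summands that vanish at `B₁` and `B₂`, counted with signs. -/
def HasVirtualType (c : Virtual (FredholmDiagram k)) (p q : ℤ) : Prop :=
  ∃ (F₁ F₂ : FredholmDiagram k) (m₁ n₁ m₂ n₂ : ℕ), F₁.1.HasType m₁ n₁ ∧ F₂.1.HasType m₂ n₂ ∧
    c = Virtual.mk F₁ F₂ ∧ p = m₁ - m₂ ∧ q = n₁ - n₂

variable {c c' : Virtual (FredholmDiagram k)} {p q : ℤ}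

/-- Every identity between classes of diagrams in the theorem reduces to this: the two signed counts
form a complete invariant. -/
lemma HasVirtualType.eq (h : HasVirtualType c p q) (h' : HasVirtualType c' p q) : c = c' := by
  obtain ⟨F₁, F₂, m₁, n₁, m₂, n₂, hF₁, hF₂, rfl, hp, hq⟩ := h
  obtain ⟨G₁, G₂, a₁, b₁, a₂, b₂, hG₁, hG₂, rfl, hp', hq'⟩ := h'
  exact Virtual.mk_eq_mk_of_hasType hF₁ hF₂ hG₁ hG₂ (by omega) (by omega)

/-- With the counts exchanged, the virtual dimensions of both sides are `p`, and dimension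
determines a virtual vector space. -/
lemma HasVirtualType.dual_H0 (h : HasVirtualType c p q) (h' : HasVirtualType c' q p) :
    c.H0.dual = c'.H1 := by
  obtain ⟨F₁, F₂, m₁, n₁, m₂, n₂, hF₁, hF₂, rfl, hp, hq⟩ := h
  obtain ⟨G₁, G₂, a₁, b₁, a₂, b₂, hG₁, hG₂, rfl, hp', hq'⟩ := h'
  refine Virtual.mk_eq_mk_of_finrank ?_
  change Module.finrank k (Module.Dual k F₁.1.H0) + Module.finrank k G₂.1.H1 =
    Module.finrank k G₁.1.H1 + Module.finrank k (Module.Dual k F₂.1.H0)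
  rw [Subspace.dual_finrank_eq, Subspace.dual_finrank_eq, hF₁.finrank_H0, hF₂.finrank_H0,
    hG₁.finrank_H1, hG₂.finrank_H1]
  omega

lemma HasVirtualType.dual_H1 (h : HasVirtualType c p q) (h' : HasVirtualType c' q p) :
    c.H1.dual = c'.H0 := by
  obtain ⟨F₁, F₂, m₁, n₁, m₂, n₂, hF₁, hF₂, rfl, hp, hq⟩ := h
  obtain ⟨G₁, G₂, a₁, b₁, a₂, b₂, hG₁, hG₂, rfl, hp', hq'⟩ := h'
  refine Virtual.mk_eq_mk_of_finrank ?_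
  change Module.finrank k (Module.Dual k F₁.1.H1) + Module.finrank k G₂.1.H0 =
    Module.finrank k G₁.1.H0 + Module.finrank k (Module.Dual k F₂.1.H1)
  rw [Subspace.dual_finrank_eq, Subspace.dual_finrank_eq, hF₁.finrank_H1, hF₂.finrank_H1,
    hG₁.finrank_H0, hG₂.finrank_H0]
  omega

variable {W : (Fin 2 → ℤ) → ℤ} {d : Fin 2 → ℤ}

lemma weightModel_hasVirtualType (h : InitiallyZero W) (h' : EventuallyZero W)
    (hp : ∀ᶠ N in atTop, lowerSum W d N = p) (hq : ∀ᶠ N in atTop, upperSum W d N = q) :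
    HasVirtualType (weightModel k W h h' d) p q := by
  obtain ⟨m₁, n₁, t₁, e₁⟩ := indicatorSum_hasType k (W := fun a => max (W a) 0)
    (fun a => le_max_right _ _) (h.comp (max · 0) (by simp)) (h'.comp (max · 0) (by simp)) d
  obtain ⟨m₂, n₂, t₂, e₂⟩ := indicatorSum_hasType k (W := fun a => max (-W a) 0)
    (fun a => le_max_right _ _) (h.comp (fun x => max (-x) 0) (by simp))
    (h'.comp (fun x => max (-x) 0) (by simp)) d
  have hW (a) : W a = max (W a) 0 - max (-W a) 0 := by omega
  obtain ⟨N, hp, hq, e₁, e₂⟩ := (hp.and (hq.and (e₁.and e₂))).exists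
  refine ⟨_, _, m₁, n₁, m₂, n₂, t₁, t₂, rfl, ?_, ?_⟩
  · rw [← hp, ← e₁.1, ← e₂.1, lowerSum, Finset.sum_congr rfl fun a _ => hW a,
      Finset.sum_sub_distrib]
    rfl
  · rw [← hq, ← e₁.2, ← e₂.2, upperSum, Finset.sum_congr rfl fun a _ => hW a,
      Finset.sum_sub_distrib]
    rfl

/-- Only the quadrant sums of `W` enter, so `c` may be any class with these counts; this covers the
weight at different base points as well as its reflection. -/
lemma HasVirtualType.representedBy {S T : Type} [Fintype S] [Fintype T]
    {P : S → (Fin 2 → ℤ) → ℤ} {Q : T → (Fin 2 → ℤ) → ℤ} (hc : HasVirtualType c p q)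
    (hP : ∀ l, IsPerfectMatching (P l)) (hQ : ∀ l, IsPerfectMatching (Q l))
    (hW : ∀ a, W a = ∑ l, P l a - ∑ l, Q l a)
    (hp : ∀ᶠ N in atTop, lowerSum W d N = p) (hq : ∀ᶠ N in atTop, upperSum W d N = q) :
    RepresentedBy c (matchingSum k P d) (matchingSum k Q d) := by
  obtain ⟨m₁, n₁, t₁, e₁⟩ := matchingSum_hasType k hP d
  obtain ⟨m₂, n₂, t₂, e₂⟩ := matchingSum_hasType k hQ d
  refine ⟨t₁.isFredholm, t₂.isFredholm, hc.eq ⟨_, _, m₁, n₁, m₂, n₂, t₁, t₂, rfl, ?_⟩⟩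
  obtain ⟨N, hp, hq, e₁, e₂⟩ := (hp.and (hq.and (e₁.and e₂))).exists
  rw [← hp, ← hq, ← e₁.1, ← e₂.1, ← e₁.2, ← e₂.2]
  constructor <;>
    simp only [lowerSum, upperSum, hW, Finset.sum_sub_distrib, finsum_eq_sum_of_fintype]

variable {n : ℕ} {f : (Fin n → ℤ) → ℤ} {C : ℤ}

/-- The restriction has offset `deg d + C` and value `f d` at `0`, so neither count depends on `i`
and `j`. -/
lemma restrictionModel_hasVirtualType (hf : IsRiemannFunction f C) (i j : Fin n)
    (d : Fin n → ℤ) :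
    HasVirtualType (restrictionModel k hf i j d) (f d) (f d - deg d - C) := by
  have h := hf.restrictTwo i j d
  refine weightModel_hasVirtualType _ _ ((h.eventually_lowerSum 0).mono fun N hN => hN.trans ?_)
    ((h.eventually_upperSum 0).mono fun N hN => hN.trans ?_)
  · simp [restrictTwo]
  · simp [restrictTwo, deg]
    ring

end VirtualTypes

/-! ### The main theorem. -/

theorem mainTheorem11 {k : Type u} [Field k] {n : ℕ} (hn : 2 ≤ n)
    (f : (Fin n → ℤ) → ℤ) (C : ℤ) (hf : IsRiemannFunction f C) (d K : Fin n → ℤ) :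
    -- the class `[M_{f at d}]` does not depend on the choice of two coordinates, nor on the way
    -- in which a weight is written as a difference of sums of perfect matchings
    (∀ i j : Fin n, i ≠ j →
      restrictionModel k hf i j d = modelAt k hn hf d ∧
      (∀ D : MatchingDecomposition (weight (restrictTwo f i j d)),
        RepresentedBy (modelAt k hn hf d) (matchingSum k D.pos 0) (matchingSum k D.neg 0)) ∧
      ((∃ M : ℤ, ∀ a, |weight (restrictTwo f i j d) a| ≤ M) →
        Nonempty (MatchingDecomposition (weight (restrictTwo f i j d))))) ∧
    -- duality
    (modelAt k hn hf d).H0.dual = (modelAt k hn (hf.riemannDual K) (K - d)).H1 ∧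
    (modelAt k hn hf d).H1.dual = (modelAt k hn (hf.riemannDual K) (K - d)).H0 ∧
    -- it arises from the two-variable duality at two coordinates (such as the first two)
    ∀ i j : Fin n, i ≠ j → ∀ d' : Fin n → ℤ, d' = d - Pi.single i (d i) - Pi.single j (d j) →
        modelAt k hn hf d =
          weightModel k (weight (restrictTwo f i j d'))
            (hf.restrictTwo i j d').weight_initiallyZero
            (hf.restrictTwo i j d').weight_eventuallyZero ![d i, d j] ∧
        modelAt k hn (hf.riemannDual K) (K - d) =
          weightModel k (dualWeight (weight (restrictTwo f i j d')) (![K i, K j] + 1))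
            ((hf.restrictTwo i j d').weight_eventuallyZero.dualWeight _)
            ((hf.restrictTwo i j d').weight_initiallyZero.dualWeight _)
            (![K i, K j] - ![d i, d j]) ∧
        ∀ D : MatchingDecomposition (weight (restrictTwo f i j d')),
          RepresentedBy (modelAt k hn hf d)
            (matchingSum k D.pos ![d i, d j]) (matchingSum k D.neg ![d i, d j]) ∧
          RepresentedBy (modelAt k hn (hf.riemannDual K) (K - d))
            (matchingSum k (fun l => dualWeight (D.pos l) (![K i, K j] + 1))
              (![K i, K j] - ![d i, d j]))
            (matchingSum k (fun l => dualWeight (D.neg l) (![K i, K j] + 1))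
              (![K i, K j] - ![d i, d j])) ∧
          HaveCanonicalDualities k D.pos (fun l => dualWeight (D.pos l) (![K i, K j] + 1))
            ![d i, d j] (![K i, K j] - ![d i, d j]) ∧
          HaveCanonicalDualities k D.neg (fun l => dualWeight (D.neg l) (![K i, K j] + 1))
            ![d i, d j] (![K i, K j] - ![d i, d j]) := by
  have hat (d : Fin n → ℤ) : HasVirtualType (modelAt k hn hf d) (f d) (f d - deg d - C) :=
    restrictionModel_hasVirtualType hf _ _ d
  -- The dual has offset `-deg K - C`; passing to it at `K - d` exchanges the two counts.
  have hat' : HasVirtualType (modelAt k hn (hf.riemannDual K) (K - d)) (f d - deg d - C) (f d) := by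
    have h := restrictionModel_hasVirtualType (k := k) (hf.riemannDual K)
      ⟨0, by omega⟩ ⟨1, by omega⟩ (K - d)
    have e : riemannDual f C K (K - d) = f d - deg d - C := by
      simp [riemannDual]
    have e' : riemannDual f C K (K - d) - deg (K - d) - (-deg K - C) = f d := by
      rw [e, deg_sub]
      ring
    rwa [e', e] at h
  refine ⟨fun i j _ => ⟨(restrictionModel_hasVirtualType hf i j d).eq (hat d), fun D => ?_, ?_⟩,
    (hat d).dual_H0 hat', (hat d).dual_H1 hat', ?_⟩
  · have h := hf.restrictTwo i j d
    exact (hat d).representedBy D.pos_perfect D.neg_perfect D.eq_sub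
      ((h.eventually_lowerSum 0).mono fun N hN => hN.trans (by simp [restrictTwo]))
      ((h.eventually_upperSum 0).mono fun N hN => hN.trans (by simp [restrictTwo, deg]; ring))
  · rintro ⟨M, hM⟩
    exact (hf.restrictTwo i j d).nonempty_matchingDecomposition hM
  · rintro i j - d' hd'
    have h := hf.restrictTwo i j d'
    have e : restrictTwo f i j d' ![d i, d j] = f d := by
      simp only [restrictTwo, hd', Matrix.cons_val_zero, Matrix.cons_val_one]
      congr 1
      abel
    -- This is the form `d + e + 1` of the reflection centre, with base points `δ` and `κ - δ`.
    have hL : ![K i, K j] + 1 = ![d i, d j] + (![K i, K j] - ![d i, d j]) + 1 := by abel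
    have hlow := (h.eventually_lowerSum ![d i, d j]).mono fun N hN => hN.trans e
    -- The offset of the restriction is `deg d' + C`, and `deg d' + d i + d j = deg d`.
    have hupp : ∀ᶠ N in Filter.atTop,
        upperSum (weight (restrictTwo f i j d')) ![d i, d j] N = f d - deg d - C :=
      (h.eventually_upperSum ![d i, d j]).mono fun N hN => hN.trans (by
        rw [e, hd', deg_sub, deg_sub, deg_single, deg_single, deg_fin_two]
        simp
        ring)
    -- Reflection turns the lower sum at `δ` into the upper sum at `κ - δ`, and conversely; this
    -- matches the exchanged counts in `hat'`.
    have hlow' := hlow.mono fun N hN =>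
      (upperSum_dualWeight _ _ (![K i, K j] - ![d i, d j]) N).trans hN
    have hupp' := hupp.mono fun N hN =>
      (lowerSum_dualWeight _ _ (![K i, K j] - ![d i, d j]) N).trans hN
    rw [← hL] at hlow' hupp'
    refine ⟨(hat d).eq (weightModel_hasVirtualType _ _ hlow hupp),
      hat'.eq (weightModel_hasVirtualType _ _ hupp' hlow'), fun D => ⟨?_, ?_, ?_, ?_⟩⟩
    · exact (hat d).representedBy D.pos_perfect D.neg_perfect D.eq_sub hlow hupp
    · exact hat'.representedBy (fun l => (D.pos_perfect l).dualWeight _)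
        (fun l => (D.neg_perfect l).dualWeight _) (fun a => D.eq_sub _) hupp' hlow'
    · exact haveCanonicalDualities D.pos_perfect hL
    · exact haveCanonicalDualities D.neg_perfect hL
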